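/- **Setting.** Let $d$ be the number of states, $I_d=\{1,\dots,d\}$, $\mathcal S^d$ the probability simplex in $\mathbb R^d$, and $\|v\|=\max_l|v^l|$ on $\mathbb R^d$. Let $c(i,\theta,\alpha)$, for $i\in I_d$, $\theta\in\mathcal S^d$, $\alpha\in(\mathbb R_0^+)^d$, be a running cost and $\psi^i(\theta)$ a terminal cost such that: $c$ is Lipschitz in $\theta$ uniformly in $\alpha$; $c$ is differentiable in $\alpha$, and $\nabla_\alpha c$ is Lipschitz in $\theta$ uniformly in $\alpha$; $c(i,\theta,\alpha)$ does not depend on $\alpha_i$; for some $\gamma>0$, $c(i,\theta,\alpha')-c(i,\theta,\alpha)\ge\nabla_\alpha c(i,\theta,\alpha)\cdot(\alpha'-\alpha)+\gamma\sum_{j\ne i}(\alpha'_j-\alpha_j)^2$ for all $i,\theta,\alpha,\alpha'$; $c$ is superlinear in $(\alpha_j)_{j\ne i}$; and $\psi$ is Lipschitz in $\theta$. Write $\Delta_iz=(z^1-z^i,\dots,z^d-z^i)$ and $$h(p,\theta,i)=\min_{\mu\in(\mathbb R_0^+)^d}c(i,\theta,\mu)+\mu\cdot p .$$ For $p=\Delta_i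 z$ let $\alpha^*_j(p,\theta,i)$, $j\ne i$, be the coordinates of a minimizer (they are unique), and $\alpha^*_i=-\sum_{j\neq i}\alpha^*_j$. **Mean field game.** A solution on $[0,T]$ with initial distribution $\theta_0\in\mathcal S^d$ is a pair $(\theta,u)$, $\theta:[0,T]\to\mathcal S^d$, $u:[0,T]\to\mathbb R^d$, with $$\dot\theta^i=\sum_j\theta^j\alpha_i^*(\Delta_ju,\theta,j),\qquad -\dot u^i=h(\Delta_iu,\theta,i),\qquad \theta(0)=\theta_0,\quad u^i(T)=\psi^i(\theta(T)).$$ **$N+1$-player game** ($N\ge1$). Let $\mathcal S^d_N=\{n\in\mathbb Z^d_{\ge0}:\sum_i n_i=N\}$ and $e_{jk}=e_j-e_k$, where $e_1,\dots,e_d$ is the canonical basis. If all players use the Markovian rates $\beta_{kj}(n,t)$, where $n$ counts the other players in each state, the pair (state $\mathbf i_t$ of a reference player, configuration $\mathbf n_t\in\mathcal S^d_N$ of the other $N$ players) is a Markov chain that jumps from $(i,n)$ to $(j,n)$, $j\neq i$, at rate $\beta_{ij}(n,t)$ and from $(i,n)$ to $(i,n+e_{jk})$, $j\ne k$, at rate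 $n_k\beta_{kj}(n+e_{ik},t)$. A control $\beta$ is admissible on $[0,T]$ if it is bounded and continuous in time, $\beta_{kj}\ge 0$ for $k\ne j$ and $\beta_{kk}=-\sum_{j\ne k}\beta_{kj}$. The Nash equilibrium on $[0,T]$ is the admissible control $\beta_{kj}(n,t)=\alpha^*_j(\Delta_ku^N_n(t),\tfrac nN,k)$, where the value function $u^N$ solves $$-\frac{du^{N,i}_n}{dt}=\sum_{k,j}n_k\,\beta_{kj}(n+e_{ik},t)\,(u^{N,i}_{n+e_{jk}}-u^{N,i}_n)+h\big(\Delta_iu^N_n,\tfrac nN,i\big),\qquad u_n^{N,i}(T)=\psi^i(\tfrac nN).$$ **Gradient horizon.** Call $T^*>0$ a gradient horizon if there is $C_0>0$ such that for all $0<T<T^*$, all $N\ge1$ and every equilibrium value function $u^N$ on $[0,T]$, $$|u^{N,i}_{n+e_{rs}}(t)-u^{N,i}_n(t)|\le \tfrac{2C_0}{N}\qquad\text{for all }t\in[0,T],\ i,r,s\in I_d,\ n\in\mathcal S^d_N\text{ with }n_s\ge1 .$$ **Theorem.** A gradient horizon exists. Moreover, for every gradient horizon $T^*$ there is a constant $C>0$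 (depending only on $d,c,\psi,T^*$; in particular not on $N$, $T$ or $\theta_0$) such that the following holds. Let $0<T<T^*$ with $\rho=TC<1$, let $\theta_0\in\mathcal S^d$, let $(\theta,u)$ be a mean field solution on $[0,T]$ with $\theta(0)=\theta_0$, let $N\ge1$, and let $u^N$ be the value function of a Nash equilibrium of the $N+1$-player game on $[0,T]$. Let $(\mathbf i_t,\mathbf n_t)$ be the chain in which all players use this equilibrium, where the $N$ players other than the reference player have i.i.d. initial states with law $\theta_0$ (so $\mathbf n_0$ is multinomial with parameters $N,\theta_0$) and the reference player's initial state is arbitrary. Then for all $t\in[0,T]$ $$\mathbb E\Big[\Big\|\frac{\mathbf n_t}{N}-\theta(t)\Big\|^2\Big]+\mathbb E\Big[\big\|u(t)-u^N_{\mathbf n_t}(t)\big\|^2\Big]\le\frac{C}{1-\rho}\,\frac1N .$$ -/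

import Mathlib

noncomputable section

namespace MeanFieldGame

/-! ### Costs, Hamiltonian and optimal rates

States are elements of `Fin d`; `ℝ^d` is `Fin d → ℝ`, with its maximum norm; the probability
simplex is `stdSimplex ℝ (Fin d)`; the orthant `(ℝ₀⁺)^d` is `Set.Ici 0`.
A running cost is `c i θ α`, a terminal cost is `ψ i θ`. -/

/-- The difference operator `Δᵢ z = (z¹ - zⁱ, …, z^d - zⁱ)`. -/
def diffOp {d : ℕ} (i : Fin d) (z : Fin d → ℝ) : Fin d → ℝ := fun j => z j - z i

/-- The standing assumptions on the running cost `c` and the terminal cost `ψ`.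
Only the values on the simplex and on the orthant matter. The gradient of `c i θ` at a point `α`
of the orthant is its (unique) derivative within the orthant. -/
structure IsGameData {d : ℕ} (c : Fin d → (Fin d → ℝ) → (Fin d → ℝ) → ℝ)
    (ψ : Fin d → (Fin d → ℝ) → ℝ) : Prop where
  /-- `c` is Lipschitz in `θ`, uniformly in `α`. -/
  lipschitz_cost : ∃ K : ℝ, ∀ i, ∀ θ ∈ stdSimplex ℝ (Fin d), ∀ θ' ∈ stdSimplex ℝ (Fin d),
    ∀ α ∈ Set.Ici (0 : Fin d → ℝ), |c i θ α - c i θ' α| ≤ K * ‖θ - θ'‖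
  /-- `c` is differentiable in `α`. -/
  differentiable_cost : ∀ i, ∀ θ ∈ stdSimplex ℝ (Fin d),
    DifferentiableOn ℝ (c i θ) (Set.Ici 0)
  /-- the gradient of `c` in `α` is Lipschitz in `θ`, uniformly in `α`. -/
  lipschitz_grad : ∃ K : ℝ, ∀ i, ∀ θ ∈ stdSimplex ℝ (Fin d), ∀ θ' ∈ stdSimplex ℝ (Fin d),
    ∀ α ∈ Set.Ici (0 : Fin d → ℝ),
      ‖fderivWithin ℝ (c i θ) (Set.Ici 0) α - fderivWithin ℝ (c i θ') (Set.Ici 0) α‖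
        ≤ K * ‖θ - θ'‖
  /-- `c i θ α` does not depend on the coordinate `α i`. -/
  indep_self : ∀ i, ∀ θ ∈ stdSimplex ℝ (Fin d), ∀ α ∈ Set.Ici (0 : Fin d → ℝ),
    ∀ α' ∈ Set.Ici (0 : Fin d → ℝ), (∀ j, j ≠ i → α j = α' j) → c i θ α = c i θ α'
  /-- `c i θ` is uniformly convex in the remaining coordinates. -/
  uniformly_convex : ∃ γ : ℝ, 0 < γ ∧ ∀ i, ∀ θ ∈ stdSimplex ℝ (Fin d),
    ∀ α ∈ Set.Ici (0 : Fin d → ℝ), ∀ α' ∈ Set.Ici (0 : Fin d → ℝ),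
      fderivWithin ℝ (c i θ) (Set.Ici 0) α (α' - α)
          + γ * ∑ j ∈ Finset.univ.erase i, (α' j - α j) ^ 2
        ≤ c i θ α' - c i θ α
  /-- `c i θ` is superlinear in the remaining coordinates. -/
  superlinear : ∀ i, ∀ θ ∈ stdSimplex ℝ (Fin d), ∀ B : ℝ, ∃ R : ℝ, 0 < R ∧
    ∀ α ∈ Set.Ici (0 : Fin d → ℝ), R ≤ ∑ j ∈ Finset.univ.erase i, α j →
      B * ∑ j ∈ Finset.univ.erase i, α j ≤ c i θ α
  /-- `ψ` is Lipschitz in `θ`. -/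
  lipschitz_terminal : ∃ K : ℝ, ∀ i, ∀ θ ∈ stdSimplex ℝ (Fin d),
    ∀ θ' ∈ stdSimplex ℝ (Fin d), |ψ i θ - ψ i θ'| ≤ K * ‖θ - θ'‖

/-- The generalized Legendre transform `h(p, θ, i) = min_{μ ≥ 0} c(i, θ, μ) + μ ⬝ p`. -/
def ham {d : ℕ} (c : Fin d → (Fin d → ℝ) → (Fin d → ℝ) → ℝ)
    (p θ : Fin d → ℝ) (i : Fin d) : ℝ :=
  sInf ((fun μ : Fin d → ℝ => c i θ μ + ∑ j, μ j * p j) '' Set.Ici 0)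

/-- A minimizer of `μ ↦ c(i, θ, μ) + μ ⬝ p` over the orthant. If `p i = 0`, all its coordinates
other than the `i`-th are uniquely determined. -/
def minimizer {d : ℕ} (c : Fin d → (Fin d → ℝ) → (Fin d → ℝ) → ℝ)
    (p θ : Fin d → ℝ) (i : Fin d) : Fin d → ℝ :=
  Classical.epsilon fun μ : Fin d → ℝ => μ ∈ Set.Ici (0 : Fin d → ℝ) ∧
    IsMinOn (fun ν : Fin d → ℝ => c i θ ν + ∑ j, ν j * p j) (Set.Ici 0) μ

/-- The optimal rates `α*(p, θ, i)`: the minimizer, with the `i`-th coordinate replaced by minus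
the sum of the others. -/
def alphaStar {d : ℕ} (c : Fin d → (Fin d → ℝ) → (Fin d → ℝ) → ℝ)
    (p θ : Fin d → ℝ) (i : Fin d) : Fin d → ℝ := fun j =>
  if j = i then -∑ l ∈ Finset.univ.erase i, minimizer c p θ i l else minimizer c p θ i j

/-! ### The mean field game -/

/-- `(θ, u)` solves the initial-terminal value problem of the mean field game on `[0, T]`. -/
structure IsMeanFieldSolution {d : ℕ} (c : Fin d → (Fin d → ℝ) → (Fin d → ℝ) → ℝ)
    (ψ : Fin d → (Fin d → ℝ) → ℝ) (T : ℝ) (θ₀ : Fin d → ℝ) (θ u : ℝ → Fin d → ℝ) : Prop where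
  mem_simplex : ∀ t ∈ Set.Icc 0 T, θ t ∈ stdSimplex ℝ (Fin d)
  kolmogorov : ∀ t ∈ Set.Icc 0 T, ∀ i, HasDerivWithinAt (fun s => θ s i)
    (∑ j, θ t j * alphaStar c (diffOp j (u t)) (θ t) j i) (Set.Icc 0 T) t
  hamilton_jacobi : ∀ t ∈ Set.Icc 0 T, ∀ i, HasDerivWithinAt (fun s => u s i)
    (-ham c (diffOp i (u t)) (θ t) i) (Set.Icc 0 T) t
  initial : θ 0 = θ₀
  terminal : ∀ i, u T i = ψ i (θ T)

/-! ### The game with `N + 1` players -/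

/-- The configurations `n` of the `N` players other than the reference player: `n k` of them are
in state `k`. -/
abbrev Conf (d N : ℕ) : Type := {n : Fin d → ℕ // ∑ k, n k = N}

/-- The configuration `n + e_j - e_k`, in which one of the players has moved from `k` to `j`.
(It is only used with the weight `n k`, so its value for `n k = 0` does not matter.) -/
def shift {d N : ℕ} (n : Conf d N) (k j : Fin d) : Conf d N :=
  if hk : n.1 k = 0 then n else
    ⟨n.1 - Pi.single k 1 + Pi.single j 1, by
      have hle : ∀ l ∈ Finset.univ, (Pi.single k 1 : Fin d → ℕ) l ≤ n.1 l := by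
        intro l _
        by_cases h : l = k
        · subst h
          simp only [Pi.single_eq_same]
          omega
        · simp [h]
      have h1 := Finset.sum_tsub_distrib Finset.univ hle
      have h2 : n.1 k ≤ ∑ l, n.1 l := Finset.single_le_sum (f := n.1) (by simp) (by simp)
      have h3 := n.2
      simp only [Pi.add_apply, Pi.sub_apply, Finset.sum_add_distrib, h1,
        Finset.sum_pi_single', Finset.mem_univ, if_true, h3]
      omega⟩

/-- The fractions `n / N`. -/
def freq {d N : ℕ} (n : Conf d N) : Fin d → ℝ := fun l => (n.1 l : ℝ) / (N : ℝ)

/-- A Markovian control: `β t n k j` is the rate at time `t` from state `k` to state `j` for a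
player who sees the configuration `n` of the other players. -/
abbrev Control (d N : ℕ) : Type := ℝ → Conf d N → Fin d → Fin d → ℝ

/-- Admissible controls on `[0, T]`. -/
structure IsAdmissible {d N : ℕ} (T : ℝ) (β : Control d N) : Prop where
  bounded : ∃ B : ℝ, ∀ t ∈ Set.Icc 0 T, ∀ n k j, |β t n k j| ≤ B
  continuous : ∀ n k j, ContinuousOn (fun t => β t n k j) (Set.Icc 0 T)
  nonneg : ∀ t ∈ Set.Icc 0 T, ∀ n k j, k ≠ j → 0 ≤ β t n k j
  diag : ∀ t ∈ Set.Icc 0 T, ∀ n k, β t n k k = -∑ j ∈ Finset.univ.erase k, β t n k j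

/-- The rate `n_k β_{kj}(n + e_i - e_k, t)` at which the configuration `n` changes to
`n + e_j - e_k` when the reference player is in state `i` and the others use `β`: a player in
state `k` sees the configuration `n + e_i - e_k`. -/
def confRate {d N : ℕ} (β : Control d N) (t : ℝ) (i : Fin d) (n : Conf d N) (k j : Fin d) : ℝ :=
  (n.1 k : ℝ) * β t (shift n k i) k j

/-- `v` (where `v t n i` is the value at time `t` in state `i` and configuration `n`) solves on
`[0, T]` the Hamilton-Jacobi system of the reference player when the other players use `β`. -/
structure IsValueFunction {d N : ℕ} (c : Fin d → (Fin d → ℝ) → (Fin d → ℝ) → ℝ)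
    (ψ : Fin d → (Fin d → ℝ) → ℝ) (T : ℝ) (β : Control d N)
    (v : ℝ → Conf d N → Fin d → ℝ) : Prop where
  hamilton_jacobi : ∀ t ∈ Set.Icc 0 T, ∀ n i, HasDerivWithinAt (fun s => v s n i)
    (-(∑ k, ∑ j, confRate β t i n k j * (v t (shift n k j) i - v t n i)
        + ham c (diffOp i (v t n)) (freq n) i)) (Set.Icc 0 T) t
  terminal : ∀ n i, v T n i = ψ i (freq n)

/-- `β` is a Nash equilibrium of the game with `N + 1` players on `[0, T]`, with value function
`v`: the best response `α*(Δ_k v_n, n / N, k)` to `β` is `β` itself. -/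
structure IsNashEquilibrium {d N : ℕ} (c : Fin d → (Fin d → ℝ) → (Fin d → ℝ) → ℝ)
    (ψ : Fin d → (Fin d → ℝ) → ℝ) (T : ℝ) (β : Control d N)
    (v : ℝ → Conf d N → Fin d → ℝ) : Prop where
  admissible : IsAdmissible T β
  value : IsValueFunction c ψ T β v
  fixed_point : ∀ t ∈ Set.Icc 0 T, ∀ n k j,
    β t n k j = alphaStar c (diffOp k (v t n)) (freq n) k j

/-- `Tstar` is a horizon for the gradient estimates of the game with `N + 1` players: for some
constant `C₀` independent of `N`, the equilibrium value functions for all horizons `T < Tstar`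
vary by at most `2 C₀ / N` when one player moves from a state `s` to a state `r`. -/
def IsGradientHorizon {d : ℕ} (c : Fin d → (Fin d → ℝ) → (Fin d → ℝ) → ℝ)
    (ψ : Fin d → (Fin d → ℝ) → ℝ) (Tstar : ℝ) : Prop :=
  0 < Tstar ∧ ∃ C₀ : ℝ, 0 < C₀ ∧ ∀ T : ℝ, 0 < T → T < Tstar → ∀ N : ℕ, 1 ≤ N →
    ∀ (β : Control d N) (v : ℝ → Conf d N → Fin d → ℝ), IsNashEquilibrium c ψ T β v →
      ∀ t ∈ Set.Icc 0 T, ∀ (n : Conf d N) (i r s : Fin d), 0 < n.1 s →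
        |v t (shift n s r) i - v t n i| ≤ 2 * C₀ / N

/-! ### The controlled Markov chain -/

/-- The transition rate at time `t` from `x = (i, n)` to `y ≠ x`, when the reference player uses
`α` and the other players use `β`. -/
def jumpRate {d N : ℕ} (α β : Control d N) (t : ℝ) (x y : Fin d × Conf d N) : ℝ :=
  (if y.2 = x.2 then α t x.2 x.1 y.1 else 0) +
    (if y.1 = x.1 then
      ∑ k, ∑ j, (if k ≠ j ∧ y.2 = shift x.2 k j then confRate β t x.1 x.2 k j else 0)
     else 0)

/-- `X` is on `[0, T]` a Markov chain with transition rates `q t x y` for `x ≠ y`: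
it has the Markov property with respect to its own past, and
`P (X_t = y | X_s = x) = q s x y * (t - s) + o(t - s)`, uniformly in time (both conditions are
multiplied by the probability of the conditioning event). -/
structure IsMarkovChain {S Ω : Type*} [MeasurableSpace S] [MeasurableSpace Ω]
    (P : MeasureTheory.Measure Ω) (T : ℝ) (q : ℝ → S → S → ℝ) (X : ℝ → Ω → S) : Prop where
  measurable : ∀ t ∈ Set.Icc 0 T, Measurable (X t)
  markov : ∀ s t, 0 ≤ s → s ≤ t → t ≤ T → ∀ A : Set Ω,
    @MeasurableSet Ω (⨆ r ∈ Set.Icc 0 s, MeasurableSpace.comap (X r) inferInstance) A →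
    ∀ x y : S,
      P.real (A ∩ {ω | X s ω = x} ∩ {ω | X t ω = y}) * P.real {ω | X s ω = x}
        = P.real (A ∩ {ω | X s ω = x}) * P.real ({ω | X s ω = x} ∩ {ω | X t ω = y})
  rates : ∀ ε : ℝ, 0 < ε → ∃ δ : ℝ, 0 < δ ∧ ∀ s t, 0 ≤ s → s < t → t ≤ T → t - s < δ →
    ∀ x y : S, x ≠ y →
      |P.real ({ω | X s ω = x} ∩ {ω | X t ω = y}) - P.real {ω | X s ω = x} * (q s x y * (t - s))|
        ≤ P.real {ω | X s ω = x} * (ε * (t - s))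

/-- The probability that `N` players, who are assigned states independently with law `θ₀`, form
the configuration `n`. -/
def initialLaw {d N : ℕ} (θ₀ : Fin d → ℝ) (n : Conf d N) : ℝ :=
  ∑ x : Fin N → Fin d,
    if (∀ k, (Finset.univ.filter fun m => x m = k).card = n.1 k) then ∏ m, θ₀ (x m) else 0

/-- `X_t = (i_t, n_t)` is the game with `N + 1` players on `[0, T]` in which all players use `β`
and the players other than the reference player have independent initial states with law `θ₀`.
The initial state of the reference player is arbitrary. -/
structure IsGameProcess {d N : ℕ} {Ω : Type*} [MeasurableSpace Ω]
    (P : MeasureTheory.Measure Ω) (T : ℝ) (θ₀ : Fin d → ℝ) (β : Control d N)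
    (X : ℝ → Ω → Fin d × Conf d N) : Prop where
  chain : IsMarkovChain P T (jumpRate β β) X
  initial : ∀ n : Conf d N, P.real {ω | (X 0 ω).2 = n} = initialLaw θ₀ n

end MeanFieldGame

end

namespace MeanFieldGame

open Set Finset

variable {d N : ℕ} {c : Fin d → (Fin d → ℝ) → (Fin d → ℝ) → ℝ} {ψ : Fin d → (Fin d → ℝ) → ℝ}

/-! ### The simplex -/

/-! The expected squared distances between empirical and limiting distribution, and between the two
value functions, satisfy a coupled forward-backward system of inequalities. Let `D₁(t)` and `D₂(t)`
be the means of `distDev` and `valueDev` along the chain. By Dynkin's formula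
(`IsMarkovChain.hasDerivWithinAt_integral`) and `IsGameData.exists_drift_bound`, each has derivative
at most `A (D₁ + D₂ + 1/N)` in absolute value. `D₁` is integrated forward from the multinomial
variance, which is `O(1/N)`. `D₂` is integrated backward from time `T`, where the Lipschitz terminal
cost gives `D₂(T) ≤ d K² D₁(T)`. Since the data sit at opposite ends, Gronwall does not apply
directly. Instead the maximum `m` of `D₁ + D₂` satisfies `m ≤ C/N + T C m`, which can be solved
because `T C < 1`.

The drift bound rests on scaling: configurations jump at total rate `O(N)`, while a jump changes the
empirical distribution by `1/N` and, by the gradient estimate, the value function by `O(1/N)`.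
Quadratic variations are therefore `O(1/N)`. The other terms are controlled by the Lipschitz
dependence of the Hamiltonian and the optimal rates on values and distribution, which comes from
uniform convexity.

The gradient estimate uses a barrier, `lt_linear_barrier`. Where a discrete gradient is maximal, the
transitions common to the two neighbouring configurations have a favourable sign, so only the
variation of the rates and the moved player contribute (`sum_confRate_shift_sub_le`). The resulting
inequality is quadratic in `N` times the gradient, hence the restriction to a short horizon. The
same barrier gives the sup bounds on the values, uniformly in `N`. -/

lemma norm_le_one_of_mem_stdSimplex {θ : Fin d → ℝ} (hθ : θ ∈ stdSimplex ℝ (Fin d)) :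
    ‖θ‖ ≤ 1 := by
  rw [pi_norm_le_iff_of_nonneg zero_le_one]
  intro l
  rw [Real.norm_of_nonneg (hθ.1 l), ← hθ.2]
  exact Finset.single_le_sum (fun j _ => hθ.1 j) (Finset.mem_univ l)

/-- A family of functions that is Lipschitz on the simplex is bounded there. -/
lemma exists_bound_of_lipschitz_simplex {ι : Type*} [Finite ι] {f : ι → (Fin d → ℝ) → ℝ} {K : ℝ}
    (hf : ∀ i, ∀ θ ∈ stdSimplex ℝ (Fin d), ∀ θ' ∈ stdSimplex ℝ (Fin d),
      |f i θ - f i θ'| ≤ K * ‖θ - θ'‖) :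
    ∃ B : ℝ, 0 < B ∧ ∀ i, ∀ θ ∈ stdSimplex ℝ (Fin d), |f i θ| ≤ B := by
  have := Fintype.ofFinite ι
  by_cases h : ∃ θ₁, θ₁ ∈ stdSimplex ℝ (Fin d)
  · obtain ⟨θ₁, h₁⟩ := h
    refine ⟨∑ i, |f i θ₁| + |K| * 2 + 1, by positivity, fun i θ hθ => ?_⟩
    have h2 : ‖θ - θ₁‖ ≤ 2 := (norm_sub_le _ _).trans (by
      linarith [norm_le_one_of_mem_stdSimplex hθ, norm_le_one_of_mem_stdSimplex h₁])
    have h3 : |f i θ₁| ≤ ∑ i, |f i θ₁| :=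
      Finset.single_le_sum (f := fun i => |f i θ₁|) (fun _ _ => abs_nonneg _) (Finset.mem_univ i)
    have h4 : K * ‖θ - θ₁‖ ≤ |K| * 2 :=
      mul_le_mul (le_abs_self K) h2 (norm_nonneg _) (abs_nonneg _)
    have h5 := abs_sub_abs_le_abs_sub (f i θ) (f i θ₁)
    linarith [hf i θ hθ θ₁ h₁]
  · push Not at h
    exact ⟨1, one_pos, fun i θ hθ => absurd hθ (h θ)⟩

lemma norm_diffOp_sub_le (i : Fin d) (z z' : Fin d → ℝ) :
    ‖diffOp i z - diffOp i z'‖ ≤ 2 * ‖z - z'‖ := by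
  rw [pi_norm_le_iff_of_nonneg (by positivity)]
  intro j
  have h1 := norm_le_pi_norm (z - z') j
  have h2 := norm_le_pi_norm (z - z') i
  simp only [Pi.sub_apply, diffOp, Real.norm_eq_abs] at *
  rw [abs_le] at *
  constructor <;> linarith

lemma diffOp_self (i : Fin d) (z : Fin d → ℝ) : diffOp i z i = 0 := by simp [diffOp]

/-! ### The minimization problem -/

/-- The function minimized in the definition of the Hamiltonian. -/
def objective (c : Fin d → (Fin d → ℝ) → (Fin d → ℝ) → ℝ) (p θ : Fin d → ℝ) (i : Fin d)
    (μ : Fin d → ℝ) : ℝ := c i θ μ + ∑ j, μ j * p j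

lemma update_zero_mem_orthant {μ : Fin d → ℝ} (hμ : μ ∈ Ici (0 : Fin d → ℝ)) (i : Fin d) :
    Function.update μ i 0 ∈ Ici (0 : Fin d → ℝ) := by
  intro j
  by_cases h : j = i
  · subst h; simp
  · simpa [Function.update_of_ne h] using hμ j

/-- The convexity and growth hypotheses say nothing about coordinate `i`. Since neither summand
depends on it when `p i = 0`, minimizers and competitors may be normalized to vanish there. -/
lemma IsGameData.objective_update (h : IsGameData c ψ) {θ : Fin d → ℝ}
    (hθ : θ ∈ stdSimplex ℝ (Fin d)) {i : Fin d} {p : Fin d → ℝ} (hp : p i = 0) {μ : Fin d → ℝ}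
    (hμ : μ ∈ Ici (0 : Fin d → ℝ)) :
    objective c p θ i (Function.update μ i 0) = objective c p θ i μ := by
  unfold objective
  congr 1
  · refine h.indep_self i θ hθ _ (update_zero_mem_orthant hμ i) _ hμ fun j hj => ?_
    simp [Function.update_of_ne hj]
  · refine Finset.sum_congr rfl fun j _ => ?_
    by_cases hj : j = i
    · subst hj; simp [hp]
    · simp [Function.update_of_ne hj]

lemma IsGameData.exists_minimizer (h : IsGameData c ψ) {θ : Fin d → ℝ}
    (hθ : θ ∈ stdSimplex ℝ (Fin d)) {i : Fin d} {p : Fin d → ℝ} (hp : p i = 0) :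
    ∃ μ ∈ Ici (0 : Fin d → ℝ), IsMinOn (objective c p θ i) (Ici 0) μ := by
  -- Slope `‖p‖ + 1` beats the linear term by the total rate `s`. Outside the box of side `R' ≥ |c i
  -- θ 0|` this already exceeds the value at `0`.
  obtain ⟨R, hR, hsup⟩ := h.superlinear i θ hθ (‖p‖ + 1)
  set R' := max R |c i θ 0| with hR'
  have hR'0 : 0 ≤ R' := hR.le.trans (le_max_left _ _)
  have hcont : ContinuousOn (objective c p θ i) (Icc 0 fun _ => R') := by
    refine ((h.differentiable_cost i θ hθ).continuousOn.mono Icc_subset_Ici_self).add ?_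
    fun_prop
  have h0 : (0 : Fin d → ℝ) ∈ Icc (0 : Fin d → ℝ) fun _ => R' := ⟨le_rfl, fun _ => hR'0⟩
  obtain ⟨μ, hμ, hmin⟩ := isCompact_Icc.exists_isMinOn ⟨0, h0⟩ hcont
  refine ⟨μ, hμ.1, fun ν hν => ?_⟩
  show objective c p θ i μ ≤ objective c p θ i ν
  rw [← h.objective_update hθ hp hν]
  have hν' := update_zero_mem_orthant hν i
  set ν' := Function.update ν i 0 with hν'def
  have hν'i : ν' i = 0 := by simp [hν'def]
  by_cases hbox : ν' ∈ Icc (0 : Fin d → ℝ) fun _ => R'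
  · exact hmin hbox
  · have : ∃ j, R' < ν' j := by
      by_contra hcon
      push Not at hcon
      exact hbox ⟨hν', hcon⟩
    obtain ⟨j, hj⟩ := this
    have hji : j ≠ i := by rintro rfl; linarith
    set s := ∑ j ∈ Finset.univ.erase i, ν' j with hs
    have hjs : ν' j ≤ s := Finset.single_le_sum (f := ν') (fun l _ => hν' l)
      (Finset.mem_erase.2 ⟨hji, Finset.mem_univ j⟩)
    have h1 := hsup ν' hν' ((le_max_left R _).trans (hj.le.trans hjs))
    have h2 : -(‖p‖ * s) ≤ ∑ j, ν' j * p j := by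
      have hs' : s = ∑ j, ν' j := by
        rw [← Finset.add_sum_erase _ _ (Finset.mem_univ i), hν'i, zero_add]
      rw [hs', Finset.mul_sum, ← Finset.sum_neg_distrib]
      refine Finset.sum_le_sum fun l _ => ?_
      have h3 := norm_le_pi_norm p l
      rw [Real.norm_eq_abs] at h3
      nlinarith [neg_abs_le (p l), show 0 ≤ ν' l from hν' l]
    have h3 : objective c p θ i μ ≤ objective c p θ i 0 := hmin h0
    have h4 : objective c p θ i 0 = c i θ 0 := by simp [objective]
    have h5 : |c i θ 0| ≤ s := (le_max_right R _).trans (hj.le.trans hjs)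
    rw [h4] at h3
    have h6 := le_abs_self (c i θ 0)
    show _ ≤ c i θ ν' + ∑ j, ν' j * p j
    linarith

lemma IsGameData.minimizer_spec (h : IsGameData c ψ) {θ : Fin d → ℝ}
    (hθ : θ ∈ stdSimplex ℝ (Fin d)) {i : Fin d} {p : Fin d → ℝ} (hp : p i = 0) :
    minimizer c p θ i ∈ Ici (0 : Fin d → ℝ) ∧
      IsMinOn (objective c p θ i) (Ici 0) (minimizer c p θ i) := by
  obtain ⟨μ, h1, h2⟩ := h.exists_minimizer hθ hp
  exact Classical.epsilon_spec (p := fun μ : Fin d → ℝ => μ ∈ Set.Ici (0 : Fin d → ℝ) ∧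
    IsMinOn (fun ν : Fin d → ℝ => c i θ ν + ∑ j, ν j * p j) (Set.Ici 0) μ) ⟨μ, h1, h2⟩

lemma IsGameData.ham_le (h : IsGameData c ψ) {θ : Fin d → ℝ}
    (hθ : θ ∈ stdSimplex ℝ (Fin d)) {i : Fin d} {p : Fin d → ℝ} (hp : p i = 0) {μ : Fin d → ℝ}
    (hμ : μ ∈ Ici (0 : Fin d → ℝ)) : ham c p θ i ≤ c i θ μ + ∑ j, μ j * p j := by
  obtain ⟨h1, h2⟩ := h.minimizer_spec hθ hp
  exact csInf_le ⟨_, by rintro _ ⟨ν, hν, rfl⟩; exact h2 hν⟩ ⟨μ, hμ, rfl⟩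

lemma IsGameData.ham_eq (h : IsGameData c ψ) {θ : Fin d → ℝ}
    (hθ : θ ∈ stdSimplex ℝ (Fin d)) {i : Fin d} {p : Fin d → ℝ} (hp : p i = 0) :
    ham c p θ i = c i θ (minimizer c p θ i) + ∑ j, minimizer c p θ i j * p j := by
  obtain ⟨h1, h2⟩ := h.minimizer_spec hθ hp
  refine le_antisymm (h.ham_le hθ hp h1) (le_csInf ⟨_, ⟨_, h1, rfl⟩⟩ ?_)
  rintro _ ⟨ν, hν, rfl⟩
  exact h2 hν

/-- Quadratic growth of the objective away from a minimizer. -/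
lemma IsGameData.exists_quadratic_growth (h : IsGameData c ψ) :
    ∃ γ : ℝ, 0 < γ ∧ ∀ i, ∀ θ ∈ stdSimplex ℝ (Fin d), ∀ p μ ν : Fin d → ℝ,
      μ ∈ Ici (0 : Fin d → ℝ) → ν ∈ Ici (0 : Fin d → ℝ) →
      IsMinOn (objective c p θ i) (Ici 0) μ →
      γ * ∑ j ∈ Finset.univ.erase i, (ν j - μ j) ^ 2
        ≤ objective c p θ i ν - objective c p θ i μ := by
  obtain ⟨γ, hγ, hc⟩ := h.uniformly_convex
  refine ⟨γ, hγ, fun i θ hθ p μ ν hμ hν hmin => ?_⟩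
  set lin : (Fin d → ℝ) →L[ℝ] ℝ := ∑ j, p j • ContinuousLinearMap.proj (R := ℝ) j with hlin
  have hlin_apply : ∀ x, lin x = ∑ j, x j * p j := fun x => by
    simp [hlin, mul_comm]
  have hd : HasFDerivWithinAt (objective c p θ i)
      (fderivWithin ℝ (c i θ) (Ici 0) μ + lin) (Ici 0) μ := by
    have h1 := (h.differentiable_cost i θ hθ μ hμ).hasFDerivWithinAt.add
      (lin.hasFDerivWithinAt (s := Ici 0) (x := μ))
    refine h1.congr (fun x _ => ?_) ?_ <;> simp [objective, hlin_apply]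
  have hseg : segment ℝ μ ν ⊆ Ici 0 := (convex_Ici 0).segment_subset hμ hν
  have h2 := hmin.localize.hasFDerivWithinAt_nonneg hd
    (sub_mem_posTangentConeAt_of_segment_subset hseg)
  have h3 := hc i θ hθ μ hμ ν hν
  simp only [_root_.add_apply, hlin_apply, Pi.sub_apply, sub_mul,
    Finset.sum_sub_distrib] at h2
  unfold objective
  linarith

/-- The minimizer depends in a Lipschitz way on the parameters. -/
lemma IsGameData.exists_lipschitz_minimizer (h : IsGameData c ψ) :
    ∃ L : ℝ, 0 < L ∧ ∀ i, ∀ θ ∈ stdSimplex ℝ (Fin d), ∀ θ' ∈ stdSimplex ℝ (Fin d),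
      ∀ p p' : Fin d → ℝ, p i = 0 → p' i = 0 → ∀ j, j ≠ i →
      |minimizer c p θ i j - minimizer c p' θ' i j| ≤ L * (‖p - p'‖ + ‖θ - θ'‖) := by
  obtain ⟨γ, hγ, hgrowth⟩ := h.exists_quadratic_growth
  obtain ⟨K, hK⟩ := h.lipschitz_grad
  -- Adding the two growth inequalities gives `2γD² ≤ (|K| ‖θ - θ'‖ + d ‖p - p'‖) D`. The extra `1`
  -- only keeps the constant positive.
  refine ⟨(|K| + d) / (2 * γ) + 1, by positivity, ?_⟩
  intro i θ hθ θ' hθ' p p' hp hp' j hj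
  obtain ⟨hm, hmin⟩ := h.minimizer_spec hθ hp
  obtain ⟨hm', hmin'⟩ := h.minimizer_spec hθ' hp'
  set μ := Function.update (minimizer c p θ i) i 0 with hμdef
  set μ' := Function.update (minimizer c p' θ' i) i 0 with hμ'def
  have hμ : μ ∈ Ici (0 : Fin d → ℝ) := update_zero_mem_orthant hm i
  have hμ' : μ' ∈ Ici (0 : Fin d → ℝ) := update_zero_mem_orthant hm' i
  have hminμ : IsMinOn (objective c p θ i) (Ici 0) μ := fun ν hν => by
    have := hmin hν
    rw [← h.objective_update hθ hp hm] at this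
    exact this
  have hminμ' : IsMinOn (objective c p' θ' i) (Ici 0) μ' := fun ν hν => by
    have := hmin' hν
    rw [← h.objective_update hθ' hp' hm'] at this
    exact this
  have e1 := hgrowth i θ hθ p μ μ' hμ hμ' hminμ
  have e2 := hgrowth i θ' hθ' p' μ' μ hμ' hμ hminμ'
  set D := ‖μ' - μ‖ with hD
  have hDle : D ^ 2 ≤ ∑ j ∈ Finset.univ.erase i, (μ' j - μ j) ^ 2 := by
    have hnn : 0 ≤ ∑ j ∈ Finset.univ.erase i, (μ' j - μ j) ^ 2 :=
      Finset.sum_nonneg fun _ _ => sq_nonneg _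
    rw [← Real.le_sqrt (norm_nonneg _) hnn, pi_norm_le_iff_of_nonneg (Real.sqrt_nonneg _)]
    intro l
    by_cases hl : l = i
    · subst hl; simp [hμdef, hμ'def]
    · rw [Real.norm_eq_abs]
      refine Real.abs_le_sqrt ?_
      exact Finset.single_le_sum (f := fun j => (μ' j - μ j) ^ 2) (fun _ _ => sq_nonneg _)
        (Finset.mem_erase.2 ⟨hl, Finset.mem_univ l⟩)
  have hsym : ∑ j ∈ Finset.univ.erase i, (μ j - μ' j) ^ 2
      = ∑ j ∈ Finset.univ.erase i, (μ' j - μ j) ^ 2 :=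
    Finset.sum_congr rfl fun _ _ => by ring
  rw [hsym] at e2
  -- The Lipschitz gradient enters here: the mean value inequality for `c i θ - c i θ'` produces a
  -- factor `‖μ' - μ‖`, without which only a square-root estimate would follow.
  have hmv : ‖(c i θ μ' - c i θ' μ') - (c i θ μ - c i θ' μ)‖ ≤ |K| * ‖θ - θ'‖ * ‖μ' - μ‖ := by
    refine Convex.norm_image_sub_le_of_norm_hasFDerivWithin_le (𝕜 := ℝ) (s := Ici 0)
      (f := fun x => c i θ x - c i θ' x)
      (f' := fun x => fderivWithin ℝ (c i θ) (Ici 0) x - fderivWithin ℝ (c i θ') (Ici 0) x)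
      (fun x hx => (h.differentiable_cost i θ hθ x hx).hasFDerivWithinAt.sub
        (h.differentiable_cost i θ' hθ' x hx).hasFDerivWithinAt)
      (fun x hx => (hK i θ hθ θ' hθ' x hx).trans ?_) (convex_Ici 0) hμ hμ'
    exact mul_le_mul_of_nonneg_right (le_abs_self K) (norm_nonneg _)
  have hlin : ∑ j, (μ' j - μ j) * (p j - p' j) ≤ d * ‖p - p'‖ * D := by
    calc ∑ j, (μ' j - μ j) * (p j - p' j) ≤ ∑ _j : Fin d, ‖p - p'‖ * D := by
          refine Finset.sum_le_sum fun l _ => ?_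
          have h1 := norm_le_pi_norm (μ' - μ) l
          have h2 := norm_le_pi_norm (p - p') l
          rw [Pi.sub_apply] at h1 h2
          calc _ ≤ ‖(μ' l - μ l) * (p l - p' l)‖ := Real.le_norm_self _
            _ = ‖p l - p' l‖ * ‖μ' l - μ l‖ := by rw [norm_mul, mul_comm]
            _ ≤ _ := mul_le_mul h2 h1 (norm_nonneg _) (norm_nonneg _)
      _ = _ := by simp [mul_assoc]
  have hsplit : ∑ j, (μ' j - μ j) * (p j - p' j)
      = ∑ j, μ' j * p j - ∑ j, μ j * p j - ∑ j, μ' j * p' j + ∑ j, μ j * p' j := by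
    rw [← Finset.sum_sub_distrib, ← Finset.sum_sub_distrib, ← Finset.sum_add_distrib]
    exact Finset.sum_congr rfl fun _ _ => by ring
  rw [Real.norm_eq_abs] at hmv
  have hmv' := le_of_abs_le hmv
  have hmain : 2 * γ * D ^ 2 ≤ (|K| * ‖θ - θ'‖ + d * ‖p - p'‖) * D := by
    unfold objective at e1 e2
    have := mul_le_mul_of_nonneg_left hDle hγ.le
    nlinarith
  have hDb : D ≤ ((|K| + d) / (2 * γ) + 1) * (‖p - p'‖ + ‖θ - θ'‖) := by
    have hD0 : 0 ≤ D := norm_nonneg _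
    have hsum : 0 ≤ ‖p - p'‖ + ‖θ - θ'‖ := by positivity
    rcases hD0.eq_or_lt with h0 | h0
    · rw [← h0]; positivity
    · have h1 : 2 * γ * D ≤ |K| * ‖θ - θ'‖ + d * ‖p - p'‖ := by
        have : (2 * γ * D) * D ≤ (|K| * ‖θ - θ'‖ + d * ‖p - p'‖) * D := by linarith
        exact le_of_mul_le_mul_right this h0
      have h2 : |K| * ‖θ - θ'‖ + d * ‖p - p'‖ ≤ (|K| + d) * (‖p - p'‖ + ‖θ - θ'‖) := by
        have : 0 ≤ |K| * ‖p - p'‖ := by positivity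
        have : 0 ≤ (d : ℝ) * ‖θ - θ'‖ := by positivity
        nlinarith
      have h3 : D ≤ (|K| + d) / (2 * γ) * (‖p - p'‖ + ‖θ - θ'‖) := by
        rw [div_mul_eq_mul_div, le_div_iff₀ (by positivity)]
        linarith
      linarith
  refine le_trans ?_ hDb
  have h1 := norm_le_pi_norm (μ' - μ) j
  rw [Pi.sub_apply, hμdef, hμ'def, Function.update_of_ne hj, Function.update_of_ne hj, norm_sub_rev,
    Real.norm_eq_abs] at h1
  exact h1

/-- The optimal rates depend in a Lipschitz way on the values and on the distribution. -/
lemma IsGameData.exists_lipschitz_alphaStar (h : IsGameData c ψ) :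
    ∃ L : ℝ, 0 < L ∧ ∀ i, ∀ θ ∈ stdSimplex ℝ (Fin d), ∀ θ' ∈ stdSimplex ℝ (Fin d),
      ∀ z z' : Fin d → ℝ, ∀ j,
      |alphaStar c (diffOp i z) θ i j - alphaStar c (diffOp i z') θ' i j|
        ≤ L * (‖z - z'‖ + ‖θ - θ'‖) := by
  obtain ⟨L, hL, hlip⟩ := h.exists_lipschitz_minimizer
  refine ⟨(d + 1) * (2 * L), by positivity, fun i θ hθ θ' hθ' z z' j => ?_⟩
  have hb : ∀ j, j ≠ i → |minimizer c (diffOp i z) θ i j - minimizer c (diffOp i z') θ' i j|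
      ≤ 2 * L * (‖z - z'‖ + ‖θ - θ'‖) := fun j hj => by
    have h1 := hlip i θ hθ θ' hθ' _ _ (diffOp_self i z) (diffOp_self i z') j hj
    have h2 := mul_le_mul_of_nonneg_left (norm_diffOp_sub_le i z z') hL.le
    have h3 : 0 ≤ L * ‖θ - θ'‖ := by positivity
    linarith
  set X := ‖z - z'‖ + ‖θ - θ'‖ with hX
  have hX0 : 0 ≤ X := by positivity
  have hd : (0 : ℝ) ≤ d := Nat.cast_nonneg d
  unfold alphaStar
  split_ifs with hj
  · rw [neg_sub_neg, abs_sub_comm, ← Finset.sum_sub_distrib]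
    refine (Finset.abs_sum_le_sum_abs _ _).trans ?_
    refine (Finset.sum_le_card_nsmul _ _ (2 * L * X) fun l hl => hb l (Finset.ne_of_mem_erase hl)).trans ?_
    rw [nsmul_eq_mul]
    have : ((Finset.univ.erase i).card : ℝ) ≤ d := by
      exact_mod_cast (Finset.card_le_univ _).trans (by simp)
    have : ((Finset.univ.erase i).card : ℝ) * (2 * L * X) ≤ (d + 1) * (2 * L * X) :=
      mul_le_mul_of_nonneg_right (by linarith) (by positivity)
    linarith
  · refine (hb j hj).trans ?_
    have : 0 ≤ d * (2 * L * X) := by positivity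
    linarith

/-- For bounded values, the Hamiltonian is Lipschitz and the optimal rates are bounded. -/
lemma IsGameData.exists_lipschitz_ham (h : IsGameData c ψ) (M : ℝ) :
    ∃ L : ℝ, 0 < L ∧ ∀ i, ∀ θ ∈ stdSimplex ℝ (Fin d), ∀ z : Fin d → ℝ, ‖z‖ ≤ M →
      (∀ j, |alphaStar c (diffOp i z) θ i j| ≤ L) ∧
      ∀ θ' ∈ stdSimplex ℝ (Fin d), ∀ z' : Fin d → ℝ, ‖z'‖ ≤ M →
        |ham c (diffOp i z) θ i - ham c (diffOp i z') θ' i| ≤ L * (‖z - z'‖ + ‖θ - θ'‖) := by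
  obtain ⟨L₁, hL₁, hlip⟩ := h.exists_lipschitz_alphaStar
  obtain ⟨K, hK⟩ := h.lipschitz_cost
  -- The rates are bounded at `z = 0`; the Lipschitz estimate carries this to `‖z‖ ≤ M`.
  obtain ⟨B, hB, hb⟩ := exists_bound_of_lipschitz_simplex (d := d) (ι := Fin d × Fin d)
    (f := fun ij θ => alphaStar c (diffOp ij.1 0) θ ij.1 ij.2) (K := L₁)
    (fun ij θ hθ θ' hθ' => by simpa using hlip ij.1 θ hθ θ' hθ' 0 0 ij.2)
  set A := B + L₁ * |M| with hA
  have hApos : 0 < A := by positivity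
  have hbound : ∀ i, ∀ θ ∈ stdSimplex ℝ (Fin d), ∀ z : Fin d → ℝ, ‖z‖ ≤ M →
      ∀ j, |alphaStar c (diffOp i z) θ i j| ≤ A := fun i θ hθ z hz j => by
    have h1 := hlip i θ hθ θ hθ z 0 j
    have h2 := hb (i, j) θ hθ
    have h3 := abs_sub_abs_le_abs_sub (alphaStar c (diffOp i z) θ i j)
      (alphaStar c (diffOp i 0) θ i j)
    simp only [sub_zero, sub_self, norm_zero, add_zero] at h1
    have h4 := mul_le_mul_of_nonneg_left (hz.trans (le_abs_self M)) hL₁.le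
    simp only at h2
    linarith
  have hhalf : ∀ i, ∀ θ ∈ stdSimplex ℝ (Fin d), ∀ z : Fin d → ℝ,
      ∀ θ' ∈ stdSimplex ℝ (Fin d), ∀ z' : Fin d → ℝ, ‖z'‖ ≤ M →
      ham c (diffOp i z) θ i - ham c (diffOp i z') θ' i
        ≤ (A + |K| + d * (A * 2)) * (‖z - z'‖ + ‖θ - θ'‖) := by
    intro i θ hθ z θ' hθ' z' hz'
    -- The minimizer for `(z', θ')` serves as competitor for `(z, θ)`.
    obtain ⟨hm, -⟩ := h.minimizer_spec hθ' (diffOp_self i z')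
    set μ := minimizer c (diffOp i z') θ' i with hμ
    have h1 := h.ham_le hθ (diffOp_self i z) hm
    rw [h.ham_eq hθ' (diffOp_self i z'), ← hμ]
    have h2 := (le_abs_self _).trans (hK i θ hθ θ' hθ' μ hm)
    have h3 : ∑ j, μ j * diffOp i z j - ∑ j, μ j * diffOp i z' j
        ≤ d * (A * (2 * ‖z - z'‖)) := by
      rw [← Finset.sum_sub_distrib]
      calc _ ≤ ∑ _j : Fin d, A * (2 * ‖z - z'‖) := by
            refine Finset.sum_le_sum fun j _ => ?_
            -- Coordinate `i` of the chosen minimizer is arbitrary and has no bound, but it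
            -- multiplies zero.
            by_cases hj : j = i
            · subst hj
              rw [diffOp_self, diffOp_self]
              have : 0 ≤ A * (2 * ‖z - z'‖) := by positivity
              simpa using this
            · have h4 := hbound i θ' hθ' z' hz' j
              rw [alphaStar, if_neg hj, ← hμ] at h4
              rw [← mul_sub]
              have h5 := (norm_le_pi_norm _ j).trans (norm_diffOp_sub_le i z z')
              rw [Pi.sub_apply, Real.norm_eq_abs] at h5
              refine (le_abs_self _).trans ?_
              rw [abs_mul]
              exact mul_le_mul h4 h5 (abs_nonneg _) hApos.le
        _ = _ := by simp
    have h4 : K * ‖θ - θ'‖ ≤ |K| * ‖θ - θ'‖ :=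
      mul_le_mul_of_nonneg_right (le_abs_self K) (norm_nonneg _)
    have h5 : 0 ≤ A * (‖z - z'‖ + ‖θ - θ'‖) + |K| * ‖z - z'‖ + d * (A * 2) * ‖θ - θ'‖ := by
      positivity
    nlinarith
  refine ⟨A + |K| + d * (A * 2), by positivity, fun i θ hθ z hz => ⟨fun j => ?_, ?_⟩⟩
  · refine (hbound i θ hθ z hz j).trans ?_
    have : 0 ≤ |K| + d * (A * 2) := by positivity
    linarith
  · intro θ' hθ' z' hz'
    rw [abs_le]
    have h1 := hhalf i θ hθ z θ' hθ' z' hz'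
    have h2 := hhalf i θ' hθ' z' θ hθ z hz
    rw [norm_sub_rev z' z, norm_sub_rev θ' θ] at h2
    constructor <;> linarith

/-- One-sided bounds on the Hamiltonian that do not depend on the values. -/
lemma IsGameData.exists_ham_bounds (h : IsGameData c ψ) :
    ∃ A : ℝ, 0 < A ∧ ∀ i, ∀ θ ∈ stdSimplex ℝ (Fin d), ∀ z : Fin d → ℝ,
      ham c (diffOp i z) θ i ≤ A ∧
      ((∀ j, z i ≤ z j) → -A ≤ ham c (diffOp i z) θ i) := by
  obtain ⟨K, hK⟩ := h.lipschitz_cost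
  obtain ⟨L, hL, hham⟩ := h.exists_lipschitz_ham 0
  obtain ⟨B₁, hB₁, hb₁⟩ := exists_bound_of_lipschitz_simplex (d := d) (ι := Fin d)
    (f := fun i θ => c i θ 0) (K := K) (fun i θ hθ θ' hθ' => hK i θ hθ θ' hθ' 0 self_mem_Ici)
  obtain ⟨B₂, hB₂, hb₂⟩ := exists_bound_of_lipschitz_simplex (d := d) (ι := Fin d)
    (f := fun i θ => ham c (diffOp i 0) θ i) (K := L) (fun i θ hθ θ' hθ' => by
      simpa using (hham i θ hθ 0 (by simp)).2 θ' hθ' 0 (by simp))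
  refine ⟨B₁ + B₂, by positivity, fun i θ hθ z => ⟨?_, fun hz => ?_⟩⟩
  · have h1 := h.ham_le hθ (diffOp_self i z) (μ := 0) self_mem_Ici
    have h2 := le_of_abs_le (hb₁ i θ hθ)
    simp only [Pi.zero_apply, zero_mul, Finset.sum_const_zero, add_zero] at h1
    linarith
  · obtain ⟨hm, -⟩ := h.minimizer_spec hθ (diffOp_self i z)
    rw [h.ham_eq hθ (diffOp_self i z)]
    -- Testing the problem with zero values against this minimizer bounds its running cost from
    -- below. The linear term is nonnegative because `z i` is minimal.
    have h1 := h.ham_le hθ (diffOp_self i 0) hm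
    have h2 : -B₂ ≤ ham c (diffOp i 0) θ i := (abs_le.1 (hb₂ i θ hθ)).1
    have h4 : ∑ j, minimizer c (diffOp i z) θ i j * diffOp i 0 j = 0 := by simp [diffOp]
    have h3 : 0 ≤ ∑ j, minimizer c (diffOp i z) θ i j * diffOp i z j :=
      Finset.sum_nonneg fun j _ => mul_nonneg (hm j) (sub_nonneg.2 (hz j))
    linarith

/-! ### Configurations -/

instance : Finite (Conf d N) := by
  refine Finite.of_injective (β := Fin d → Fin (N + 1))
    (fun n k => ⟨n.1 k, Nat.lt_succ_of_le ?_⟩) fun n n' h => ?_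
  · calc n.1 k ≤ ∑ l, n.1 l := Finset.single_le_sum (f := n.1) (by simp) (by simp)
      _ = N := n.2
  · ext k
    simpa using congrArg Fin.val (congrFun h k)

lemma shift_of_eq_zero {n : Conf d N} {k : Fin d} (h : n.1 k = 0) (j : Fin d) :
    shift n k j = n := by simp [shift, h]

lemma shift_val {n : Conf d N} {k : Fin d} (h : 0 < n.1 k) (j l : Fin d) :
    (shift n k j).1 l = n.1 l - (if l = k then 1 else 0) + (if l = j then 1 else 0) := by
  simp [shift, h.ne', Pi.single_apply]

lemma shift_self (n : Conf d N) (k : Fin d) : shift n k k = n := by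
  rcases Nat.eq_zero_or_pos (n.1 k) with h | h
  · exact shift_of_eq_zero h k
  · ext l
    rw [shift_val h]
    by_cases hl : l = k
    · subst hl; simp; omega
    · simp [hl]

lemma shift_pos {n : Conf d N} {k : Fin d} (h : 0 < n.1 k) (j : Fin d) :
    0 < (shift n k j).1 j := by
  rw [shift_val h]; simp

lemma shift_shift_cancel {n : Conf d N} {s : Fin d} (h : 0 < n.1 s) (r : Fin d) :
    shift (shift n s r) r s = n := by
  ext l
  rw [shift_val (shift_pos h r), shift_val h]
  split_ifs <;> subst_vars <;> omega

/-- Two moves that start from different players commute. -/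
lemma shift_shift_comm {n : Conf d N} {k s : Fin d} (hs : 0 < n.1 s)
    (hk : (if k = s then 1 else 0) < n.1 k) (j r : Fin d) :
    shift (shift n s r) k j = shift (shift n k j) s r := by
  have hk0 : 0 < n.1 k := lt_of_le_of_lt (Nat.zero_le _) hk
  have h1 : 0 < (shift n s r).1 k := by
    rw [shift_val hs]; split_ifs at hk ⊢ <;> omega
  have h2 : 0 < (shift n k j).1 s := by
    rw [shift_val hk0]; split_ifs at hk ⊢ <;> subst_vars <;> omega
  ext l
  rw [shift_val h1, shift_val h2, shift_val hs, shift_val hk0]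
  by_cases e1 : l = s <;> by_cases e2 : l = k <;> by_cases e3 : l = j <;> by_cases e4 : l = r <;>
    by_cases e5 : k = s <;> simp_all <;> omega

lemma freq_mem_stdSimplex (hN : 1 ≤ N) (n : Conf d N) : freq n ∈ stdSimplex ℝ (Fin d) := by
  refine ⟨fun l => by unfold freq; positivity, ?_⟩
  have hN0 : (N : ℝ) ≠ 0 := by positivity
  simp only [freq]
  rw [← Finset.sum_div, ← Nat.cast_sum, n.2, div_self hN0]

lemma freq_shift {n : Conf d N} {k : Fin d} (h : 0 < n.1 k) (j l : Fin d) :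
    freq (shift n k j) l
      = freq n l + ((if l = j then 1 else 0) - (if l = k then 1 else 0)) / (N : ℝ) := by
  have h1 : (if l = k then 1 else 0) ≤ n.1 l := by split_ifs <;> subst_vars <;> omega
  simp only [freq]
  rw [shift_val h, Nat.cast_add, Nat.cast_sub h1]
  push_cast
  ring

lemma norm_freq_shift_sub_le (n : Conf d N) (k j : Fin d) :
    ‖freq (shift n k j) - freq n‖ ≤ 1 / N := by
  rcases Nat.eq_zero_or_pos (n.1 k) with h | h
  · rw [shift_of_eq_zero h, sub_self, norm_zero]; positivity
  · rw [pi_norm_le_iff_of_nonneg (by positivity)]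
    intro l
    rw [Pi.sub_apply, freq_shift h, add_sub_cancel_left, Real.norm_eq_abs, abs_div, Nat.abs_cast]
    gcongr
    split_ifs <;> simp

/-! ### A comparison principle for finite systems -/

/-- If a finite family stays at time `T` below a level `Y`, and its derivative exceeds `-A` at any
place where it touches the barrier `Y + A (T - t)` from below, then it stays below the barrier. -/
lemma lt_linear_barrier {ι : Type*} [Finite ι] {T Y A : ℝ} {w w' : ℝ → ι → ℝ}
    (hw : ∀ t ∈ Icc 0 T, ∀ a, HasDerivWithinAt (fun s => w s a) (w' t a) (Icc 0 T) t)
    (hT : ∀ a, w T a < Y)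
    (htouch : ∀ t ∈ Icc 0 T, ∀ a, w t a = Y + A * (T - t) →
      (∀ b, w t b ≤ Y + A * (T - t)) → -A < w' t a) :
    ∀ t ∈ Icc 0 T, ∀ a, w t a < Y + A * (T - t) := by
  by_contra hcon
  push Not at hcon
  have hcontw : ∀ a, ContinuousOn (fun s => w s a - (Y + A * (T - s))) (Icc 0 T) := fun a =>
    ContinuousOn.sub (fun t ht => (hw t ht a).continuousWithinAt) (by fun_prop)
  -- The argument is run at the last time `t₀` at which some component reaches the barrier. By
  -- continuity from the right, all components lie weakly below it at `t₀`.
  set S : Set ℝ := ⋃ a, Icc 0 T ∩ (fun s => w s a - (Y + A * (T - s))) ⁻¹' Ici 0 with hS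
  have hclosed : IsClosed S := isClosed_iUnion_of_finite fun a =>
    (hcontw a).preimage_isClosed_of_isClosed isClosed_Icc isClosed_Ici
  have hsub : S ⊆ Icc 0 T := iUnion_subset fun a => inter_subset_left
  obtain ⟨t₁, ht₁, a₁, ha₁⟩ := hcon
  have hne : S.Nonempty := ⟨t₁, mem_iUnion.2 ⟨a₁, ht₁, sub_nonneg.2 ha₁⟩⟩
  obtain ⟨t₀, ht₀S, hmax⟩ := (isCompact_Icc.of_isClosed_subset hclosed hsub).exists_isGreatest hne
  have ht₀ := hsub ht₀S
  obtain ⟨a, -, ha⟩ := mem_iUnion.1 ht₀S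
  have ha' : 0 ≤ w t₀ a - (Y + A * (T - t₀)) := ha
  have hlt : t₀ < T := by
    rcases ht₀.2.eq_or_lt with h | h
    · rw [h] at ha'
      have := hT a
      linarith
    · exact h
  have hafter : ∀ s ∈ Ioc t₀ T, ∀ b, w s b - (Y + A * (T - s)) < 0 := fun s hs b => by
    by_contra hge
    push Not at hge
    have : s ∈ S := mem_iUnion.2 ⟨b, ⟨ht₀.1.trans hs.1.le, hs.2⟩, hge⟩
    exact absurd (hmax this) (not_le.2 hs.1)
  have hIoc : Ioc t₀ T ∈ nhdsWithin t₀ (Ioi t₀) := Ioc_mem_nhdsGT hlt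
  have hle_nhds : nhdsWithin t₀ (Ioi t₀) ≤ nhdsWithin t₀ (Icc 0 T) :=
    nhdsWithin_le_of_mem (Filter.mem_of_superset hIoc
      fun s hs => ⟨ht₀.1.trans hs.1.le, hs.2⟩)
  have hle : ∀ b, w t₀ b - (Y + A * (T - t₀)) ≤ 0 := fun b =>
    le_of_tendsto (((hcontw b) t₀ ht₀).tendsto.mono_left hle_nhds)
      (Filter.mem_of_superset hIoc fun s hs => (hafter s hs b).le)
  have htou := htouch t₀ ht₀ a (by linarith [hle a]) (fun b => by linarith [hle b])
  -- The right derivative at `t₀` is `w' + A > 0` by `htouch`, while all difference quotients to the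
  -- right are nonpositive.
  have hd : HasDerivWithinAt (fun s => w s a - (Y + A * (T - s))) (w' t₀ a - (A * (0 - 1)))
      (Ioi t₀) t₀ := by
    refine ((hw t₀ ht₀ a).mono_of_mem_nhdsWithin (Filter.mem_of_superset hIoc
      fun s hs => ⟨ht₀.1.trans hs.1.le, hs.2⟩)).sub ?_
    exact ((((hasDerivAt_const t₀ T).sub (hasDerivAt_id t₀)).const_mul A).const_add Y).hasDerivWithinAt
  rw [hasDerivWithinAt_iff_tendsto_slope' self_notMem_Ioi] at hd
  have hslope : ∀ s ∈ Ioc t₀ T, slope (fun s => w s a - (Y + A * (T - s))) t₀ s ≤ 0 := by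
    intro s hs
    rw [slope_def_field]
    refine div_nonpos_of_nonpos_of_nonneg ?_ (sub_nonneg.2 hs.1.le)
    linarith [hafter s hs a]
  have := le_of_tendsto hd (Filter.mem_of_superset hIoc hslope)
  linarith

/-- A priori bound for systems of Hamilton-Jacobi type with a monotone coupling `g`. -/
lemma IsGameData.exists_apriori_bound (h : IsGameData c ψ) (S : ℝ) :
    ∃ M : ℝ, 0 < M ∧ ∀ T : ℝ, 0 < T → T ≤ S → ∀ (ι : Type) [Finite ι]
      (v θ g : ℝ → ι → Fin d → ℝ),
      (∀ t ∈ Icc 0 T, ∀ a, θ t a ∈ stdSimplex ℝ (Fin d)) →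
      (∀ t ∈ Icc 0 T, ∀ a i, HasDerivWithinAt (fun s => v s a i)
        (-(g t a i + ham c (diffOp i (v t a)) (θ t a) i)) (Icc 0 T) t) →
      (∀ t ∈ Icc 0 T, ∀ a i, (∀ b, v t b i ≤ v t a i) → g t a i ≤ 0) →
      (∀ t ∈ Icc 0 T, ∀ a i, (∀ b, v t a i ≤ v t b i) → 0 ≤ g t a i) →
      (∀ a i, v T a i = ψ i (θ T a)) →
      ∀ t ∈ Icc 0 T, ∀ a, ‖v t a‖ ≤ M := by
  obtain ⟨A, hA, hham⟩ := h.exists_ham_bounds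
  obtain ⟨K, hK⟩ := h.lipschitz_terminal
  obtain ⟨B, hB, hb⟩ := exists_bound_of_lipschitz_simplex hK
  refine ⟨B + 1 + (A + 1) * |S|, by positivity, ?_⟩
  intro T hT hTS ι _ v θ g hθ hder hg1 hg2 hterm t ht a
  have hTmem : T ∈ Icc 0 T := right_mem_Icc.2 hT.le
  have hup := lt_linear_barrier (ι := ι × Fin d) (T := T) (Y := B + 1) (A := A + 1)
    (w := fun t a => v t a.1 a.2) (fun t ht a => hder t ht a.1 a.2)
    (fun a => by
      have := le_of_abs_le (hb a.2 _ (hθ T hTmem a.1))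
      simp only [hterm]
      linarith)
    -- A touching component is maximal over all configurations and states, so the coupling is
    -- nonpositive, and the Hamiltonian is at most `A < A + 1`.
    (fun t ht a ha hle => by
      have h1 := hg1 t ht a.1 a.2 fun b => by simpa only [ha] using hle (b, a.2)
      have h2 := (hham a.2 _ (hθ t ht a.1) (v t a.1)).1
      linarith)
  have hlow := lt_linear_barrier (ι := ι × Fin d) (T := T) (Y := B + 1) (A := A + 1)
    (w := fun t a => -v t a.1 a.2) (fun t ht a => (hder t ht a.1 a.2).neg)
    (fun a => by
      have := (abs_le.1 (hb a.2 _ (hθ T hTmem a.1))).1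
      simp only [hterm]
      linarith)
    -- Now the component is minimal. Minimality over configurations gives the sign of `g`, and
    -- minimality over states is what the lower bound on the Hamiltonian needs.
    (fun t ht a ha hle => by
      have h1 := hg2 t ht a.1 a.2 fun b => by
        have := hle (b, a.2)
        simp only at this ha
        linarith
      have h2 := (hham a.2 _ (hθ t ht a.1) (v t a.1)).2 fun j => by
        have := hle (a.1, j)
        simp only at this ha
        linarith
      linarith)
  rw [pi_norm_le_iff_of_nonneg (by positivity)]
  intro i
  have h1 := hup t ht (a, i)
  have h2 := hlow t ht (a, i)
  have h3 : (A + 1) * (T - t) ≤ (A + 1) * |S| :=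
    mul_le_mul_of_nonneg_left (by linarith [ht.1, le_abs_self S]) (by positivity)
  simp only at h1 h2
  rw [Real.norm_eq_abs, abs_le]
  constructor <;> linarith

/-- Maximum principle for the jump operator. The diagonal rates are negative, but the corresponding
moves leave `n` unchanged. -/
lemma IsAdmissible.sum_confRate_mul_nonpos {T : ℝ} {β : Control d N} (hβ : IsAdmissible T β)
    {t : ℝ} (ht : t ∈ Icc 0 T) (i : Fin d) (n : Conf d N) {f : Conf d N → ℝ}
    (hf : ∀ m, f m ≤ f n) :
    ∑ k, ∑ j, confRate β t i n k j * (f (shift n k j) - f n) ≤ 0 := by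
  refine Finset.sum_nonpos fun k _ => Finset.sum_nonpos fun j _ => ?_
  by_cases hkj : k = j
  · subst hkj; simp [shift_self]
  · exact mul_nonpos_of_nonneg_of_nonpos
      (mul_nonneg (Nat.cast_nonneg _) (hβ.nonneg t ht _ k j hkj)) (sub_nonpos.2 (hf _))

/-- The influence of the other players is a jump operator in `n`, so it has the right sign at
extrema whatever `N` and `β` are. The bound is therefore uniform in both. -/
lemma IsGameData.exists_valueFunction_bound (h : IsGameData c ψ) (S : ℝ) :
    ∃ M : ℝ, 0 < M ∧ ∀ T : ℝ, 0 < T → T ≤ S → ∀ N : ℕ, 1 ≤ N →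
      ∀ (β : Control d N) (v : ℝ → Conf d N → Fin d → ℝ), IsAdmissible T β →
      IsValueFunction c ψ T β v → ∀ t ∈ Icc 0 T, ∀ n, ‖v t n‖ ≤ M := by
  obtain ⟨M, hM, hb⟩ := h.exists_apriori_bound S
  refine ⟨M, hM, fun T hT hTS N hN β v hβ hv => ?_⟩
  refine hb T hT hTS (Conf d N) v (fun _ n => freq n)
    (fun t n i => ∑ k, ∑ j, confRate β t i n k j * (v t (shift n k j) i - v t n i))
    (fun t ht n => freq_mem_stdSimplex hN n) hv.hamilton_jacobi ?_ ?_ hv.terminal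
  · intro t ht n i hle
    exact hβ.sum_confRate_mul_nonpos ht i n (f := fun m => v t m i) hle
  · intro t ht n i hle
    have := hβ.sum_confRate_mul_nonpos ht i n (f := fun m => -v t m i)
      (fun m => neg_le_neg (hle m))
    simp only [← neg_sub', mul_neg, Finset.sum_neg_distrib] at this
    linarith

/-- The mean field equation is the case of a single configuration without coupling. -/
lemma IsGameData.exists_meanField_bound (h : IsGameData c ψ) (S : ℝ) :
    ∃ M : ℝ, 0 < M ∧ ∀ T : ℝ, 0 < T → T ≤ S → ∀ (θ₀ : Fin d → ℝ) (θ u : ℝ → Fin d → ℝ),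
      IsMeanFieldSolution c ψ T θ₀ θ u → ∀ t ∈ Icc 0 T, ‖u t‖ ≤ M := by
  obtain ⟨M, hM, hb⟩ := h.exists_apriori_bound S
  refine ⟨M, hM, fun T hT hTS θ₀ θ u hs t ht => ?_⟩
  exact hb T hT hTS Unit (fun t _ => u t) (fun t _ => θ t) (fun _ _ _ => 0)
    (fun t ht _ => hs.mem_simplex t ht) (fun t ht _ i => by simpa using hs.hamilton_jacobi t ht i)
    (fun _ _ _ _ _ => le_rfl) (fun _ _ _ _ _ => le_rfl) (fun _ i => hs.terminal i) t ht ()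

/-! ### Gradient estimates -/

/-- Where a difference `f (n + e_r - e_s) - f n` attains its maximal possible value `φ`, the drift
of the difference is controlled by the variation of the rates alone. -/
lemma sum_confRate_shift_sub_le {β : Control d N} {t B φ E : ℝ} {f : Conf d N → ℝ}
    (i : Fin d) {n : Conf d N} {s r : Fin d} (hs : 0 < n.1 s) (hE0 : 0 ≤ E)
    (hnn : ∀ n k j, k ≠ j → 0 ≤ β t n k j) (hB : ∀ n k j, |β t n k j| ≤ B)
    (hE : ∀ (n : Conf d N) s r, 0 < n.1 s → ∀ k j, |β t (shift n s r) k j - β t n k j| ≤ E)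
    (hf : ∀ (n : Conf d N) s r, 0 < n.1 s → |f (shift n s r) - f n| ≤ φ)
    (hmax : f (shift n s r) - f n = φ) :
    ∑ k, ∑ j, confRate β t i (shift n s r) k j * (f (shift (shift n s r) k j) - f (shift n s r))
      - ∑ k, ∑ j, confRate β t i n k j * (f (shift n k j) - f n)
      ≤ N * (d * (E * φ)) + 2 * (d * (B * φ)) := by
  have hφ : 0 ≤ φ := (abs_nonneg _).trans (hf n s r hs)
  have hB0 : 0 ≤ B := (abs_nonneg _).trans (hB n s s)
  set n' := shift n s r with hn'
  have key : ∀ k j, confRate β t i n' k j * (f (shift n' k j) - f n')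
      - confRate β t i n k j * (f (shift n k j) - f n)
      ≤ (n.1 k : ℝ) * (E * φ) + ((if k = r then B * φ else 0) + if k = s then B * φ else 0) := by
    intro k j
    by_cases hkj : k = j
    · subst hkj
      rw [shift_self, shift_self, sub_self, sub_self, mul_zero, mul_zero, sub_self]
      positivity
    set X := β t (shift n' k i) k j * (f (shift n' k j) - f n') with hX
    set Y := β t (shift n k i) k j * (f (shift n k j) - f n) with hY
    -- Of the players in state `k`, `n.1 k - δs` are common to both configurations; `δs` and `δr`
    -- count the moved player before and after the move.
    set δs : ℕ := if k = s then 1 else 0 with hδs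
    set δr : ℕ := if k = r then 1 else 0 with hδr
    have hle : δs ≤ n.1 k := by rw [hδs]; split_ifs <;> subst_vars <;> omega
    have hval : n'.1 k = n.1 k - δs + δr := shift_val hs r k
    have hcast : (n.1 k : ℝ) = ((n.1 k - δs : ℕ) : ℝ) + δs := by
      rw [Nat.cast_sub hle]; ring
    have hsplit : confRate β t i n' k j * (f (shift n' k j) - f n')
        - confRate β t i n k j * (f (shift n k j) - f n)
        = ((n.1 k - δs : ℕ) : ℝ) * (X - Y) + (δr * X - δs * Y) := by
      simp only [confRate]
      rw [hval, Nat.cast_add, mul_assoc, mul_assoc, ← hX, ← hY]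
      linear_combination (-Y) * hcast
    have hXr : δr * X ≤ if k = r then B * φ else 0 := by
      rw [hδr]
      split_ifs with e
      · have h1 : 0 < n'.1 k := by rw [hval, hδr, if_pos e]; omega
        rw [Nat.cast_one, one_mul]
        refine (le_abs_self _).trans ?_
        rw [hX, abs_mul]
        exact mul_le_mul (hB _ _ _) (hf n' k j h1) (abs_nonneg _) hB0
      · simp
    have hYs : -(δs * Y) ≤ if k = s then B * φ else 0 := by
      rw [hδs]
      split_ifs with e
      · rw [Nat.cast_one, one_mul]
        refine (neg_le_abs _).trans ?_
        rw [hY, abs_mul]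
        exact mul_le_mul (hB _ _ _) (hf n k j (e ▸ hs)) (abs_nonneg _) hB0
      · simp
    have hXY : ((n.1 k - δs : ℕ) : ℝ) * (X - Y) ≤ (n.1 k : ℝ) * (E * φ) := by
      have hEφ : 0 ≤ E * φ := by positivity
      rcases Nat.eq_zero_or_pos (n.1 k - δs) with h0 | h0
      · rw [h0, Nat.cast_zero, zero_mul]; positivity
      have hk : δs < n.1 k := by omega
      have hk0 : 0 < n.1 k := by omega
      have h1 : 0 < n'.1 k := by omega
      have h2 : ∀ l, 0 < (shift n k l).1 s := fun l => by
        rw [shift_val hk0]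
        rw [hδs] at hk
        split_ifs at hk ⊢ <;> subst_vars <;> omega
      have h3 : X - Y ≤ E * φ := by
        -- For the common players, the two moves commute and `φ` is the gradient at `n`. The first
        -- summand is a nonnegative rate times (gradient after the jump minus maximal gradient),
        -- hence nonpositive; only the variation of the rates is left.
        have e1 : X - Y = β t (shift n k i) k j
              * ((f (shift (shift n k j) s r) - f (shift n k j)) - φ)
            + (β t (shift (shift n k i) s r) k j - β t (shift n k i) k j)
              * (f (shift n' k j) - f n') := by
          rw [hX, hY, ← hmax, hn', shift_shift_comm hs hk i r, shift_shift_comm hs hk j r]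
          ring
        have e2 := mul_nonpos_of_nonneg_of_nonpos (hnn (shift n k i) k j hkj)
          (sub_nonpos.2 (le_of_abs_le (hf (shift n k j) s r (h2 j))))
        have e3 : (β t (shift (shift n k i) s r) k j - β t (shift n k i) k j)
              * (f (shift n' k j) - f n') ≤ E * φ := by
          refine (le_abs_self _).trans ?_
          rw [abs_mul]
          exact mul_le_mul (hE _ s r (h2 i) k j) (hf n' k j h1) (abs_nonneg _) hE0
        linarith
      calc ((n.1 k - δs : ℕ) : ℝ) * (X - Y) ≤ ((n.1 k - δs : ℕ) : ℝ) * (E * φ) :=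
            mul_le_mul_of_nonneg_left h3 (Nat.cast_nonneg _)
        _ ≤ _ := mul_le_mul_of_nonneg_right (Nat.cast_le.2 (Nat.sub_le _ _)) hEφ
    linarith
  have hsum : ∑ k, (n.1 k : ℝ) = N := by rw [← Nat.cast_sum, n.2]
  calc _ = ∑ k, ∑ j, (confRate β t i n' k j * (f (shift n' k j) - f n')
      - confRate β t i n k j * (f (shift n k j) - f n)) := by
        simp only [Finset.sum_sub_distrib]
    _ ≤ ∑ k, ∑ _j : Fin d, ((n.1 k : ℝ) * (E * φ)
          + ((if k = r then B * φ else 0) + if k = s then B * φ else 0)) :=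
        Finset.sum_le_sum fun k _ => Finset.sum_le_sum fun j _ => key k j
    _ = N * (d * (E * φ)) + 2 * (d * (B * φ)) := by
        simp only [Finset.sum_const, Finset.card_univ, Fintype.card_fin, nsmul_eq_mul, mul_add,
          Finset.sum_add_distrib, ← Finset.mul_sum, ← Finset.sum_mul, hsum, Finset.sum_ite_eq',
          Finset.mem_univ, if_true]
        ring

/-- The gradient estimate: a gradient horizon exists. -/
theorem IsGameData.exists_gradientHorizon (h : IsGameData c ψ) :
    ∃ Tstar : ℝ, IsGradientHorizon c ψ Tstar := by
  obtain ⟨M, hM, hbound⟩ := h.exists_valueFunction_bound 1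
  obtain ⟨Lα, hLα, hα⟩ := h.exists_lipschitz_alphaStar
  obtain ⟨Lh, hLh, hh⟩ := h.exists_lipschitz_ham M
  obtain ⟨K, hK⟩ := h.lipschitz_terminal
  set Y : ℝ := |K| + 1 with hY
  have hYpos : 0 < Y := by positivity
  -- `A - 1` is `N` times the bound on the drift and Hamiltonian terms when the gradient is at most
  -- `(Y + 1) / N`. The last `1` makes the touching inequality strict.
  set A : ℝ := d * (Lα * (Y + 2) * (Y + 1)) + 2 * (d * (Lh * (Y + 1))) + Lh * (Y + 2) + 1 with hA
  have hApos : 0 < A := by positivity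
  -- `T ≤ 1` selects the a priori bound, and `A T ≤ 1` keeps the barrier below `(Y + 1) / N`, which
  -- is `2 C₀ / N`.
  refine ⟨min 1 (1 / A), by positivity, (Y + 1) / 2, by positivity, ?_⟩
  intro T hT hTS N hN β v hnash
  have hT1 : T ≤ 1 := hTS.le.trans (min_le_left _ _)
  have hTA : A * T ≤ 1 := by
    have h1 : T ≤ 1 / A := hTS.le.trans (min_le_right _ _)
    rw [le_div_iff₀ hApos] at h1
    linarith
  have hNpos : (0 : ℝ) < N := by exact_mod_cast hN
  have hvb := hbound T hT hT1 N hN β v hnash.admissible hnash.value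
  have hbar := lt_linear_barrier
    (ι := {a : Conf d N × Fin d × Fin d × Fin d // 0 < a.1.1 a.2.1}) (T := T) (Y := Y / N)
    (A := A / N) (w := fun t a => v t (shift a.1.1 a.1.2.1 a.1.2.2.1) a.1.2.2.2 - v t a.1.1 a.1.2.2.2)
    (fun t ht a => (hnash.value.hamilton_jacobi t ht (shift a.1.1 a.1.2.1 a.1.2.2.1) a.1.2.2.2).sub
      (hnash.value.hamilton_jacobi t ht a.1.1 a.1.2.2.2)) ?_ ?_
  · intro t ht n i r s hs
    have h1 := hbar t ht ⟨(n, s, r, i), hs⟩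
    -- The reverse move belongs to the same family, so the one-sided barrier bounds the absolute
    -- value.
    have h2 := hbar t ht ⟨(shift n s r, r, s, i), shift_pos hs r⟩
    simp only [shift_shift_cancel hs] at h1 h2
    have h3 : Y / N + A / N * (T - t) ≤ 2 * ((Y + 1) / 2) / N := by
      rw [div_mul_eq_mul_div, ← add_div]
      gcongr
      nlinarith [ht.1]
    rw [abs_le]
    constructor <;> linarith
  · rintro ⟨⟨n, s, r, i⟩, hs⟩
    simp only
    rw [hnash.value.terminal, hnash.value.terminal]
    have h1 := (le_abs_self _).trans (hK i _ (freq_mem_stdSimplex hN (shift n s r)) _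
      (freq_mem_stdSimplex hN n))
    have h2 : K * ‖freq (shift n s r) - freq n‖ ≤ |K| * (1 / N) :=
      mul_le_mul (le_abs_self K) (norm_freq_shift_sub_le n s r) (norm_nonneg _) (abs_nonneg _)
    have h3 : |K| * (1 / N) < Y / N := by
      rw [mul_one_div]
      gcongr
      linarith
    linarith
  · rintro t ht ⟨⟨n, s, r, i⟩, hs⟩ heq hle
    simp only at heq
    set φ := Y / N + A / N * (T - t) with hφ
    have hφle : φ ≤ (Y + 1) / N := by
      rw [hφ, div_mul_eq_mul_div, ← add_div]
      gcongr
      nlinarith [ht.1]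
    have hgrad : ∀ (n : Conf d N) s r, 0 < n.1 s → ∀ i, |v t (shift n s r) i - v t n i| ≤ φ := by
      intro n s r hs i
      have h1 := hle ⟨(n, s, r, i), hs⟩
      have h2 := hle ⟨(shift n s r, r, s, i), shift_pos hs r⟩
      simp only [shift_shift_cancel hs] at h1 h2
      rw [abs_le]
      constructor <;> linarith
    have hφ0 : 0 ≤ φ := (abs_nonneg _).trans (hgrad n s r hs i)
    have hgradn : ∀ (n : Conf d N) s r, 0 < n.1 s → ‖v t (shift n s r) - v t n‖ ≤ φ :=
      fun n s r hs => (pi_norm_le_iff_of_nonneg hφ0).2 fun i => hgrad n s r hs i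
    have hN1 : (0 : ℝ) < 1 / N := by positivity
    have hdrift := sum_confRate_shift_sub_le (β := β) (t := t) (B := Lh) (φ := φ)
      (E := Lα * (φ + 1 / N)) (f := fun m => v t m i) i hs (by positivity)
      (fun n k j hkj => hnash.admissible.nonneg t ht n k j hkj)
      (fun n k j => by
        rw [hnash.fixed_point t ht]
        exact (hh k _ (freq_mem_stdSimplex hN n) (v t n) (hvb t ht n)).1 j)
      (fun n s r hs k j => by
        rw [hnash.fixed_point t ht, hnash.fixed_point t ht]
        refine (hα k _ (freq_mem_stdSimplex hN _) _ (freq_mem_stdSimplex hN _) _ _ j).trans ?_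
        gcongr
        · exact hgradn n s r hs
        · exact norm_freq_shift_sub_le n s r)
      (fun n s r hs => hgrad n s r hs i) heq
    have hhd := (le_abs_self _).trans ((hh i _ (freq_mem_stdSimplex hN (shift n s r))
      (v t (shift n s r)) (hvb t ht _)).2 _ (freq_mem_stdSimplex hN n) (v t n) (hvb t ht _))
    have hhd2 : Lh * (‖v t (shift n s r) - v t n‖ + ‖freq (shift n s r) - freq n‖)
        ≤ Lh * ((Y + 1) / N + 1 / N) := by
      gcongr
      · exact (hgradn n s r hs).trans hφle
      · exact norm_freq_shift_sub_le n s r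
    -- The variation of the rates and the gradient are both `O(1/N)`, so the factor `N` leaves
    -- `O(1/N)`, the order of the barrier's slope.
    have hd1 : (N : ℝ) * (d * (Lα * (φ + 1 / N) * φ))
        ≤ N * (d * (Lα * ((Y + 1) / N + 1 / N) * ((Y + 1) / N))) := by gcongr
    have hd2 : 2 * (d * (Lh * φ)) ≤ 2 * (d * (Lh * ((Y + 1) / N))) := by gcongr
    have hfin : N * (d * (Lα * ((Y + 1) / N + 1 / N) * ((Y + 1) / N)))
        + 2 * (d * (Lh * ((Y + 1) / N))) + Lh * ((Y + 1) / N + 1 / N) = (A - 1) / N := by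
      rw [hA]
      field_simp
      ring
    have hfin2 : (A - 1) / N = A / N - 1 / N := sub_div _ _ _
    simp only at hdrift ⊢
    linarith

open MeasureTheory

/-! ### Expectations along a finite Markov chain -/

section Chain

variable {S Ω : Type*} [Fintype S] [MeasurableSpace S] [MeasurableSingletonClass S]
  [MeasurableSpace Ω] {P : Measure Ω} [IsProbabilityMeasure P]

lemma integral_comp_eq_sum {Y : Ω → S} (hY : Measurable Y) (F : S → ℝ) :
    ∫ ω, F (Y ω) ∂P = ∑ x, P.real {ω | Y ω = x} * F x := by
  have hint : Integrable F (P.map Y) := .of_finite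
  rw [← integral_map hY.aemeasurable hint.aestronglyMeasurable, integral_fintype hint]
  refine Finset.sum_congr rfl fun x _ => ?_
  rw [map_measureReal_apply hY (measurableSet_singleton x), smul_eq_mul]
  rfl

lemma sum_real_eq_one {Y : Ω → S} (hY : Measurable Y) : ∑ x, P.real {ω | Y ω = x} = 1 := by
  simpa using (integral_comp_eq_sum (P := P) hY fun _ => 1).symm

lemma real_eq_sum_inter {Y Z : Ω → S} (hY : Measurable Y) (hZ : Measurable Z) (y : S) :
    P.real {ω | Z ω = y} = ∑ x, P.real ({ω | Y ω = x} ∩ {ω | Z ω = y}) := by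
  rw [← measureReal_biUnion_finset]
  · congr 1
    ext ω
    simp
  · intro x _ x' _ hxx'
    refine Set.disjoint_left.2 fun ω h1 h2 => hxx' ?_
    exact h1.1.symm.trans h2.1
  · exact fun x _ => (hY (measurableSet_singleton x)).inter (hZ (measurableSet_singleton y))

variable [DecidableEq S] {T : ℝ} {q : ℝ → S → S → ℝ} {X : ℝ → Ω → S}

/-- Over a short time, the law of the chain evolves by the forward equation. -/
lemma IsMarkovChain.exists_abs_increment_le (hX : IsMarkovChain P T q X) {ε : ℝ} (hε : 0 < ε) :
    ∃ δ : ℝ, 0 < δ ∧ ∀ s t, 0 ≤ s → s < t → t ≤ T → t - s < δ → ∀ y,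
      |P.real {ω | X t ω = y} - P.real {ω | X s ω = y}
        - (t - s) * ∑ x ∈ Finset.univ.erase y, (P.real {ω | X s ω = x} * q s x y
            - P.real {ω | X s ω = y} * q s y x)| ≤ ε * (t - s) := by
  set κ : ℝ := 2 * Fintype.card S + 1 with hκ
  have hκpos : 0 < κ := by positivity
  obtain ⟨δ, hδ, hrate⟩ := hX.rates (ε / κ) (by positivity)
  refine ⟨δ, hδ, fun s t hs hst htT htδ y => ?_⟩
  have hms := hX.measurable s ⟨hs, hst.le.trans htT⟩
  have hmt := hX.measurable t ⟨hs.trans hst.le, htT⟩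
  have h1 := real_eq_sum_inter (P := P) hms hmt y
  have h2 := real_eq_sum_inter (P := P) hmt hms y
  rw [← Finset.add_sum_erase _ _ (Finset.mem_univ y)] at h1 h2
  have hb : ∀ x y, x ≠ y → |P.real ({ω | X s ω = x} ∩ {ω | X t ω = y})
      - P.real {ω | X s ω = x} * (q s x y * (t - s))| ≤ ε / κ * (t - s) := fun x y hxy =>
    (hrate s t hs hst htT htδ x y hxy).trans
      (mul_le_of_le_one_left (by have := sub_pos.2 hst; positivity) measureReal_le_one)
  -- The event of being in `y` at both times cancels between the two decompositions, so only rates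
  -- between distinct states enter.
  have hid : P.real {ω | X t ω = y} - P.real {ω | X s ω = y}
        - (t - s) * ∑ x ∈ Finset.univ.erase y, (P.real {ω | X s ω = x} * q s x y
            - P.real {ω | X s ω = y} * q s y x)
      = ∑ x ∈ Finset.univ.erase y,
        ((P.real ({ω | X s ω = x} ∩ {ω | X t ω = y})
            - P.real {ω | X s ω = x} * (q s x y * (t - s)))
          - (P.real ({ω | X s ω = y} ∩ {ω | X t ω = x})
            - P.real {ω | X s ω = y} * (q s y x * (t - s)))) := by
    rw [h1, h2, Set.inter_comm {ω | X t ω = y} {ω | X s ω = y}, add_sub_add_left_eq_sub,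
      ← Finset.sum_sub_distrib, Finset.mul_sum, ← Finset.sum_sub_distrib]
    refine Finset.sum_congr rfl fun x _ => ?_
    rw [Set.inter_comm {ω | X t ω = x} {ω | X s ω = y}]
    ring
  rw [hid]
  refine (Finset.abs_sum_le_sum_abs _ _).trans ((Finset.sum_le_card_nsmul _ _
    (2 * (ε / κ * (t - s))) fun x hx => ?_).trans ?_)
  · have hxy := Finset.ne_of_mem_erase hx
    refine (abs_sub _ _).trans ?_
    linarith [hb x y hxy, hb y x hxy.symm]
  · rw [nsmul_eq_mul]
    have hc : ((Finset.univ.erase y).card : ℝ) ≤ Fintype.card S := by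
      exact_mod_cast Finset.card_le_univ _
    have h0 : 0 < t - s := sub_pos.2 hst
    calc _ ≤ (Fintype.card S : ℝ) * (2 * (ε / κ * (t - s))) :=
          mul_le_mul_of_nonneg_right hc (by positivity)
      _ = (2 * Fintype.card S) * (ε * (t - s)) / κ := by ring
      _ ≤ κ * (ε * (t - s)) / κ := by gcongr; linarith
      _ = _ := by field_simp

/-- The forward equation. The derivative is one-sided because the infinitesimal description uses the
rates at the earlier time. -/
lemma IsMarkovChain.hasDerivWithinAt_law (hX : IsMarkovChain P T q X) {s : ℝ} (hs : s ∈ Ico 0 T)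
    (y : S) :
    HasDerivWithinAt (fun t => P.real {ω | X t ω = y})
      (∑ x ∈ Finset.univ.erase y, (P.real {ω | X s ω = x} * q s x y
            - P.real {ω | X s ω = y} * q s y x)) (Ici s) s := by
  rw [hasDerivWithinAt_iff_isLittleO, Asymptotics.isLittleO_iff]
  intro ε hε
  obtain ⟨δ, hδ, h⟩ := hX.exists_abs_increment_le hε
  have h1 : Ico s (min T (s + δ)) ∈ nhdsWithin s (Ici s) :=
    Ico_mem_nhdsGE (lt_min hs.2 (by linarith))
  filter_upwards [h1] with t ht
  rcases ht.1.eq_or_lt with rfl | hst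
  · simp
  · have h2 := (lt_min_iff.1 ht.2)
    rw [Real.norm_eq_abs, Real.norm_of_nonneg (sub_pos.2 hst).le, smul_eq_mul]
    exact h s t hs.1 hst h2.1.le (by linarith) y

/-- Bounded rates make the law locally Lipschitz. Two-sided continuity is needed to integrate right
derivatives and does not follow from them. -/
lemma IsMarkovChain.continuousOn_law (hX : IsMarkovChain P T q X) {B : ℝ}
    (hq : ∀ t ∈ Icc 0 T, ∀ x y, |q t x y| ≤ B) (y : S) :
    ContinuousOn (fun t => P.real {ω | X t ω = y}) (Icc 0 T) := by
  obtain ⟨δ, hδ, h⟩ := hX.exists_abs_increment_le one_pos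
  set κ : ℝ := Fintype.card S * (2 * |B|) + 1 with hκ
  have hκpos : 0 < κ := by positivity
  have hlip : ∀ s t, 0 ≤ s → s < t → t ≤ T → t - s < δ →
      |P.real {ω | X t ω = y} - P.real {ω | X s ω = y}| ≤ κ * (t - s) := by
    intro s t hs hst htT htδ
    have h1 := h s t hs hst htT htδ y
    have hmem : s ∈ Icc 0 T := ⟨hs, hst.le.trans htT⟩
    have hterm : ∀ x y, |P.real {ω | X s ω = x} * q s x y| ≤ |B| := fun x y => by
      rw [abs_mul, abs_of_nonneg measureReal_nonneg]
      exact (mul_le_of_le_one_left (abs_nonneg _) measureReal_le_one).trans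
        ((hq s hmem x y).trans (le_abs_self B))
    have h2 : |∑ x ∈ Finset.univ.erase y, (P.real {ω | X s ω = x} * q s x y
            - P.real {ω | X s ω = y} * q s y x)| ≤ Fintype.card S * (2 * |B|) := by
      refine (Finset.abs_sum_le_sum_abs _ _).trans ((Finset.sum_le_card_nsmul _ _
        (2 * |B|) fun x _ => ?_).trans ?_)
      · refine (abs_sub _ _).trans ?_
        linarith [hterm x y, hterm y x]
      · rw [nsmul_eq_mul]
        gcongr
        exact Finset.card_le_univ _
    have h3 : |(t - s) * ∑ x ∈ Finset.univ.erase y, (P.real {ω | X s ω = x} * q s x y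
            - P.real {ω | X s ω = y} * q s y x)| ≤ (t - s) * (Fintype.card S * (2 * |B|)) := by
      rw [abs_mul, abs_of_pos (sub_pos.2 hst)]
      exact mul_le_mul_of_nonneg_left h2 (sub_pos.2 hst).le
    have h4 := abs_sub_abs_le_abs_sub (P.real {ω | X t ω = y} - P.real {ω | X s ω = y})
      ((t - s) * ∑ x ∈ Finset.univ.erase y, (P.real {ω | X s ω = x} * q s x y
            - P.real {ω | X s ω = y} * q s y x))
    rw [hκ]
    linarith
  rw [Metric.continuousOn_iff]
  intro s hs ε hε
  refine ⟨min δ (ε / κ), by positivity, fun t ht hst => ?_⟩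
  rw [Real.dist_eq, lt_min_iff, lt_div_iff₀ hκpos] at hst
  rw [Real.dist_eq]
  rcases lt_trichotomy s t with hlt | rfl | hlt
  · rw [abs_of_pos (sub_pos.2 hlt)] at hst
    linarith [hlip s t hs.1 hlt ht.2 hst.1]
  · simpa using hε
  · rw [abs_sub_comm, abs_of_pos (sub_pos.2 hlt)] at hst
    rw [abs_sub_comm]
    linarith [hlip t s ht.1 hlt hs.2 hst.1]

lemma IsMarkovChain.continuousOn_integral (hX : IsMarkovChain P T q X) {B : ℝ}
    (hq : ∀ t ∈ Icc 0 T, ∀ x y, |q t x y| ≤ B) {f : ℝ → S → ℝ}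
    (hf : ∀ x, ContinuousOn (fun t => f t x) (Icc 0 T)) :
    ContinuousOn (fun t => ∫ ω, f t (X t ω) ∂P) (Icc 0 T) := by
  have h1 : ContinuousOn (fun t => ∑ x, P.real {ω | X t ω = x} * f t x) (Icc 0 T) :=
    continuousOn_finsetSum _ fun x _ => (hX.continuousOn_law hq x).mul (hf x)
  exact h1.congr fun t ht => integral_comp_eq_sum (hX.measurable t ht) (f t)

/-- Dynkin's formula, in differential form. -/
lemma IsMarkovChain.hasDerivWithinAt_integral (hX : IsMarkovChain P T q X) {t : ℝ}
    (ht : t ∈ Ico 0 T) {f : ℝ → S → ℝ} {f' : S → ℝ}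
    (hf : ∀ x, HasDerivWithinAt (fun s => f s x) (f' x) (Ici t) t) :
    HasDerivWithinAt (fun s => ∫ ω, f s (X s ω) ∂P)
      (∑ x, P.real {ω | X t ω = x} *
        (f' x + ∑ y ∈ Finset.univ.erase x, q t x y * (f t y - f t x))) (Ici t) t := by
  have h1 : HasDerivWithinAt (fun s => ∑ x, P.real {ω | X s ω = x} * f s x)
      (∑ y, ((∑ x ∈ Finset.univ.erase y, (P.real {ω | X t ω = x} * q t x y
            - P.real {ω | X t ω = y} * q t y x)) * f t y
          + P.real {ω | X t ω = y} * f' y)) (Ici t) t :=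
    HasDerivWithinAt.fun_sum fun y _ => (hX.hasDerivWithinAt_law ht y).mul (hf y)
  have hI : Ico t T ∈ nhdsWithin t (Ici t) := Ico_mem_nhdsGE ht.2
  have heq : (fun s => ∫ ω, f s (X s ω) ∂P) =ᶠ[nhdsWithin t (Ici t)]
      fun s => ∑ x, P.real {ω | X s ω = x} * f s x := by
    filter_upwards [hI] with s hs
    exact integral_comp_eq_sum (hX.measurable s ⟨ht.1.trans hs.1, hs.2.le⟩) (f s)
  have h2 := h1.congr_of_eventuallyEq heq (integral_comp_eq_sum (hX.measurable t ⟨ht.1, ht.2.le⟩) (f t))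
  refine h2.congr_deriv ?_
  simp only [← Finset.filter_ne', Finset.sum_filter, mul_add, Finset.sum_add_distrib,
    Finset.sum_mul, Finset.mul_sum]
  rw [add_comm]
  congr 1
  have e1 : ∑ x, ∑ y, (if y ≠ x then P.real {ω | X t ω = y} * q t y x
        - P.real {ω | X t ω = x} * q t x y else 0) * f t x
      = ∑ x, ∑ y, (if y ≠ x then P.real {ω | X t ω = y} * q t y x * f t x else 0)
        - ∑ x, ∑ y, (if y ≠ x then P.real {ω | X t ω = x} * q t x y * f t x else 0) := by
    simp only [← Finset.sum_sub_distrib]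
    refine Finset.sum_congr rfl fun x _ => Finset.sum_congr rfl fun y _ => ?_
    split_ifs <;> ring
  have e2 : ∑ x, ∑ y, P.real {ω | X t ω = x} * (if y ≠ x then q t x y * (f t y - f t x) else 0)
      = ∑ x, ∑ y, (if y ≠ x then P.real {ω | X t ω = x} * q t x y * f t y else 0)
        - ∑ x, ∑ y, (if y ≠ x then P.real {ω | X t ω = x} * q t x y * f t x else 0) := by
    simp only [← Finset.sum_sub_distrib]
    refine Finset.sum_congr rfl fun x _ => Finset.sum_congr rfl fun y _ => ?_
    split_ifs <;> ring
  -- Exchanging the summation variables in the gain term transfers the generator from the law to the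
  -- test function.
  rw [e1, e2, Finset.sum_comm]
  congr 1
  refine Finset.sum_congr rfl fun x _ => Finset.sum_congr rfl fun y _ => ?_
  simp only [ne_comm]

end Chain

/-! ### The variance of the initial configuration -/

/-- Total mass, mean and variance of a sum of independent centred variables, by induction on the
first player. The first two statements are needed to remove the cross term in the third. -/
lemma sum_prod_moments {θ g : Fin d → ℝ} (hθ : ∑ a, θ a = 1) (hg : ∑ a, θ a * g a = 0) (N : ℕ) :
    ∑ x : Fin N → Fin d, ∏ m, θ (x m) = 1 ∧
    ∑ x : Fin N → Fin d, (∏ m, θ (x m)) * ∑ m, g (x m) = 0 ∧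
    ∑ x : Fin N → Fin d, (∏ m, θ (x m)) * (∑ m, g (x m)) ^ 2 = N * ∑ a, θ a * g a ^ 2 := by
  induction N with
  | zero => simp
  | succ N ih =>
    obtain ⟨h0, h1, h2⟩ := ih
    have hcons : ∀ F : (Fin (N + 1) → Fin d) → ℝ,
        ∑ x, F x = ∑ a, ∑ x : Fin N → Fin d, F (Fin.cons a x) := fun F => by
      rw [← Fintype.sum_prod_type']
      exact (Equiv.sum_comp (Fin.consEquiv fun _ => Fin d) F).symm
    simp only [hcons, Fin.prod_univ_succ, Fin.sum_univ_succ, Fin.cons_zero, Fin.cons_succ]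
    refine ⟨?_, ?_, ?_⟩
    · simp only [← Finset.mul_sum, h0, mul_one, hθ]
    · calc _ = ∑ a, (θ a * g a * ∑ x : Fin N → Fin d, ∏ m, θ (x m)
            + θ a * ∑ x : Fin N → Fin d, (∏ m, θ (x m)) * ∑ m, g (x m)) := by
            refine Finset.sum_congr rfl fun a _ => ?_
            rw [Finset.mul_sum, Finset.mul_sum, ← Finset.sum_add_distrib]
            exact Finset.sum_congr rfl fun x _ => by ring
        _ = 0 := by rw [h0, h1]; simp [hg]
    · calc _ = ∑ a, (θ a * g a ^ 2 * ∑ x : Fin N → Fin d, ∏ m, θ (x m)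
            + 2 * (θ a * g a) * ∑ x : Fin N → Fin d, (∏ m, θ (x m)) * ∑ m, g (x m)
            + θ a * ∑ x : Fin N → Fin d, (∏ m, θ (x m)) * (∑ m, g (x m)) ^ 2) := by
            refine Finset.sum_congr rfl fun a _ => ?_
            rw [Finset.mul_sum, Finset.mul_sum, Finset.mul_sum, ← Finset.sum_add_distrib,
              ← Finset.sum_add_distrib]
            exact Finset.sum_congr rfl fun x _ => by ring
        _ = _ := by
            rw [h0, h1, h2]
            simp only [mul_one, mul_zero, add_zero, Finset.sum_add_distrib, ← Finset.sum_mul, hθ]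
            push_cast
            ring

/-- The configuration formed by players with states `x`. -/
def countConf (x : Fin N → Fin d) : Conf d N :=
  ⟨fun k => (Finset.univ.filter fun m => x m = k).card, by
    simpa using (Finset.card_eq_sum_card_fiberwise (s := Finset.univ) (t := Finset.univ)
      (f := x) (fun _ _ => Finset.mem_coe.2 (Finset.mem_univ _))).symm⟩

/-- The initial law is the image of the product law under counting, so expectations can be computed
on individual assignments. -/
lemma sum_initialLaw_mul [Fintype (Conf d N)] (θ₀ : Fin d → ℝ) (F : Conf d N → ℝ) :
    ∑ n, initialLaw θ₀ n * F n = ∑ x : Fin N → Fin d, (∏ m, θ₀ (x m)) * F (countConf x) := by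
  classical
  simp only [initialLaw, Finset.sum_mul]
  rw [Finset.sum_comm]
  refine Finset.sum_congr rfl fun x _ => ?_
  rw [Finset.sum_eq_single (countConf x)]
  · have h : ∀ k, (Finset.univ.filter fun m => x m = k).card = (countConf x).1 k := fun k => rfl
    rw [if_pos h]
  · intro n _ hn
    rw [if_neg, zero_mul]
    exact fun h => hn (Subtype.ext (funext fun k => (h k).symm))
  · simp

/-- The deviation is the average of `N` independent centred indicators, each of variance at most
`1`. -/
lemma sum_initialLaw_mul_sq_le [Fintype (Conf d N)] (hN : 1 ≤ N) {θ₀ : Fin d → ℝ}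
    (hθ : θ₀ ∈ stdSimplex ℝ (Fin d)) (l : Fin d) :
    ∑ n : Conf d N, initialLaw θ₀ n * (freq n l - θ₀ l) ^ 2 ≤ 1 / N := by
  have hNpos : (0 : ℝ) < N := by exact_mod_cast hN
  rw [sum_initialLaw_mul θ₀ fun n => (freq n l - θ₀ l) ^ 2]
  set g : Fin d → ℝ := fun a => (if a = l then 1 else 0) - θ₀ l with hg
  have hg0 : ∑ a, θ₀ a * g a = 0 := by
    simp [hg, mul_sub, Finset.sum_sub_distrib, ← Finset.sum_mul, hθ.2]
  have hfreq : ∀ x : Fin N → Fin d, freq (countConf x) l - θ₀ l = (∑ m, g (x m)) / N := by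
    intro x
    simp only [freq, countConf, hg, Finset.sum_sub_distrib, Finset.sum_const, Finset.card_univ,
      Fintype.card_fin, nsmul_eq_mul, Finset.sum_boole]
    field_simp
  have h2 := (sum_prod_moments hθ.2 hg0 N).2.2
  have hle : ∑ a, θ₀ a * g a ^ 2 ≤ 1 := by
    rw [← hθ.2]
    refine Finset.sum_le_sum fun a _ => mul_le_of_le_one_right (hθ.1 a) ?_
    have h1 : θ₀ l ≤ 1 := (Real.le_norm_self _).trans
      ((norm_le_pi_norm θ₀ l).trans (norm_le_one_of_mem_stdSimplex hθ))
    have h0 := hθ.1 l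
    rw [sq_le_one_iff_abs_le_one, hg, abs_le]
    constructor <;> dsimp only <;> split_ifs <;> linarith
  simp only [hfreq, div_pow, ← mul_div_assoc, ← Finset.sum_div]
  rw [h2, div_le_div_iff₀ (by positivity) hNpos]
  nlinarith

/-! ### The generator of the game process -/

/-- For a function of the configuration alone, a jump of the reference player changes nothing, so
only the moves of the others survive. -/
lemma sum_jumpRate_mul [Fintype (Conf d N)] [DecidableEq (Fin d × Conf d N)] (α β : Control d N)
    (t : ℝ) (x : Fin d × Conf d N) (F : Conf d N → ℝ) :
    ∑ y ∈ Finset.univ.erase x, jumpRate α β t x y * (F y.2 - F x.2)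
      = ∑ k, ∑ j, confRate β t x.1 x.2 k j * (F (shift x.2 k j) - F x.2) := by
  rw [← Finset.filter_ne', Finset.sum_filter]
  have h1 : ∀ y : Fin d × Conf d N, (if y ≠ x then jumpRate α β t x y * (F y.2 - F x.2) else 0)
      = if y.1 = x.1 then ∑ k, ∑ j, (if y.2 = shift x.2 k j then
          confRate β t x.1 x.2 k j * (F (shift x.2 k j) - F x.2) else 0) else 0 := by
    intro y
    have h2 : (if y ≠ x then jumpRate α β t x y * (F y.2 - F x.2) else 0)
        = jumpRate α β t x y * (F y.2 - F x.2) := by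
      split_ifs with h
      · rfl
      · rw [not_not.1 h, sub_self, mul_zero]
    rw [h2, jumpRate, add_mul]
    have h3 : (if y.2 = x.2 then α t x.2 x.1 y.1 else 0) * (F y.2 - F x.2) = 0 := by
      split_ifs with h
      · rw [h, sub_self, mul_zero]
      · rw [zero_mul]
    rw [h3, zero_add]
    split_ifs with h
    · rw [Finset.sum_mul]
      refine Finset.sum_congr rfl fun k _ => ?_
      rw [Finset.sum_mul]
      refine Finset.sum_congr rfl fun j _ => ?_
      by_cases hkj : k = j
      · subst hkj; simp [shift_self]
      · by_cases hy : y.2 = shift x.2 k j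
        · rw [if_pos ⟨hkj, hy⟩, if_pos hy, hy]
        · rw [if_neg fun h => hy h.2, if_neg hy, zero_mul]
    · rw [zero_mul]
  simp only [h1]
  rw [Fintype.sum_prod_type, Finset.sum_comm]
  simp only [Finset.sum_ite_eq', Finset.mem_univ, if_true]
  rw [Finset.sum_comm]
  refine Finset.sum_congr rfl fun k _ => ?_
  rw [Finset.sum_comm]
  refine Finset.sum_congr rfl fun j _ => ?_
  simp

lemma abs_confRate_le {β : Control d N} {t B : ℝ} (hB : ∀ n k j, |β t n k j| ≤ B) (i : Fin d)
    (n : Conf d N) (k j : Fin d) : |confRate β t i n k j| ≤ n.1 k * B := by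
  rw [confRate, abs_mul, Nat.abs_cast]
  exact mul_le_mul_of_nonneg_left (hB _ _ _) (Nat.cast_nonneg _)

lemma abs_jumpRate_le {α β : Control d N} {t B : ℝ} (hα : ∀ n k j, |α t n k j| ≤ B)
    (hβ : ∀ n k j, |β t n k j| ≤ B) (x y : Fin d × Conf d N) :
    |jumpRate α β t x y| ≤ B + d * (d * (N * B)) := by
  have hB0 : 0 ≤ B := (abs_nonneg _).trans (hα x.2 x.1 x.1)
  refine (abs_add_le _ _).trans (add_le_add ?_ ?_)
  · split_ifs
    · exact hα _ _ _
    · simpa using hB0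
  · split_ifs
    · refine (Finset.abs_sum_le_sum_abs _ _).trans ?_
      refine (Finset.sum_le_card_nsmul _ _ (d * (N * B)) fun k _ => ?_).trans (by simp)
      refine (Finset.abs_sum_le_sum_abs _ _).trans ?_
      refine (Finset.sum_le_card_nsmul _ _ (N * B) fun j _ => ?_).trans (by simp)
      split_ifs
      · refine (abs_confRate_le hβ _ _ _ _).trans (mul_le_mul_of_nonneg_right ?_ hB0)
        have : x.2.1 k ≤ ∑ l, x.2.1 l := Finset.single_le_sum (f := x.2.1) (by simp) (by simp)
        rw [x.2.2] at this
        exact_mod_cast this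
      · rw [abs_zero]; positivity
    · rw [abs_zero]; positivity

lemma abs_sum_sum_le {n : Conf d N} {R : Fin d → Fin d → ℝ} {E : ℝ}
    (hR : ∀ k j, |R k j| ≤ n.1 k * E) : |∑ k, ∑ j, R k j| ≤ d * (N * E) := by
  have hsum : ∑ k, (n.1 k : ℝ) = N := by rw [← Nat.cast_sum, n.2]
  calc |∑ k, ∑ j, R k j| ≤ ∑ k, ∑ j, |R k j| :=
        (Finset.abs_sum_le_sum_abs _ _).trans
          (Finset.sum_le_sum fun k _ => Finset.abs_sum_le_sum_abs _ _)
    _ ≤ ∑ k, ∑ _j : Fin d, (n.1 k : ℝ) * E :=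
        Finset.sum_le_sum fun k _ => Finset.sum_le_sum fun j _ => hR k j
    _ = d * (N * E) := by
        simp only [Finset.sum_const, Finset.card_univ, Fintype.card_fin, nsmul_eq_mul,
          ← Finset.mul_sum, ← Finset.sum_mul, hsum]

/-- Drift of the squared distance between the empirical distribution and `θ`, when `θ` moves by
the Kolmogorov equation with rates `α`. -/
lemma abs_distribution_drift_le {β : Control d N} {t B E : ℝ} {θ : Fin d → ℝ}
    {α : Fin d → Fin d → ℝ} (hN : 1 ≤ N) (hθ : θ ∈ stdSimplex ℝ (Fin d))
    (hB : ∀ n k j, |β t n k j| ≤ B) (hrow : ∀ n k, ∑ j, β t n k j = 0) (i : Fin d)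
    (n : Conf d N) (l : Fin d) (hE : ∀ k, |β t (shift n k i) k l - α k l| ≤ E) :
    |2 * (freq n l - θ l) * -(∑ k, θ k * α k l)
        + ∑ k, ∑ j, confRate β t i n k j * ((freq (shift n k j) l - θ l) ^ 2 - (freq n l - θ l) ^ 2)|
      ≤ 2 * ‖freq n - θ‖ * (d * (‖freq n - θ‖ * B) + E) + d * B / N := by
  have hNpos : (0 : ℝ) < N := by exact_mod_cast hN
  set D : Fin d → Fin d → ℝ :=
    fun k j => ((if l = j then 1 else 0) - (if l = k then 1 else 0)) / (N : ℝ) with hD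
  -- Expansion of the square separates the drift of the empirical distribution from its quadratic
  -- variation.
  have hterm : ∀ k j, confRate β t i n k j
        * ((freq (shift n k j) l - θ l) ^ 2 - (freq n l - θ l) ^ 2)
      = 2 * (freq n l - θ l) * (confRate β t i n k j * D k j)
        + confRate β t i n k j * D k j ^ 2 := by
    intro k j
    rcases Nat.eq_zero_or_pos (n.1 k) with h | h
    · simp [confRate, h]
    · rw [freq_shift h]
      show _ * ((_ + D k j - _) ^ 2 - _) = _
      ring
  -- Zero row sums absorb the departures into the diagonal rate, giving the form of the Kolmogorov
  -- equation.
  have hfirst : ∑ k, ∑ j, confRate β t i n k j * D k j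
      = ∑ k, freq n k * β t (shift n k i) k l := by
    refine Finset.sum_congr rfl fun k _ => ?_
    have h1 : ∀ j, confRate β t i n k j * D k j
        = freq n k * ((if l = j then β t (shift n k i) k j else 0)
          - (if l = k then 1 else 0) * β t (shift n k i) k j) := by
      intro j
      simp only [confRate, hD, freq]
      split_ifs <;> ring
    simp only [h1]
    rw [← Finset.mul_sum, Finset.sum_sub_distrib, ← Finset.mul_sum, hrow]
    simp
  have hsecond : |∑ k, ∑ j, confRate β t i n k j * D k j ^ 2| ≤ d * B / N := by
    have h1 := abs_sum_sum_le (n := n) (R := fun k j => confRate β t i n k j * D k j ^ 2)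
      (E := B * (1 / (N : ℝ)) ^ 2) fun k j => by
        rw [abs_mul, ← mul_assoc, abs_of_nonneg (sq_nonneg (D k j))]
        refine mul_le_mul (abs_confRate_le hB i n k j) ?_ (sq_nonneg _)
          ((abs_nonneg _).trans (abs_confRate_le hB i n k j))
        rw [hD]
        simp only [div_pow]
        refine div_le_div_of_nonneg_right ?_ (by positivity)
        split_ifs <;> norm_num
    refine h1.trans (le_of_eq ?_)
    field_simp
  have hdiff : |∑ k, (freq n k * β t (shift n k i) k l - θ k * α k l)|
      ≤ d * (‖freq n - θ‖ * B) + E := by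
    have h1 : ∀ k, |freq n k * β t (shift n k i) k l - θ k * α k l|
        ≤ ‖freq n - θ‖ * B + θ k * E := by
      intro k
      have h2 : freq n k * β t (shift n k i) k l - θ k * α k l
          = (freq n k - θ k) * β t (shift n k i) k l
            + θ k * (β t (shift n k i) k l - α k l) := by ring
      rw [h2]
      refine (abs_add_le _ _).trans (add_le_add ?_ ?_)
      · rw [abs_mul]
        exact mul_le_mul (norm_le_pi_norm (freq n - θ) k) (hB _ _ _) (abs_nonneg _)
          (norm_nonneg _)
      · rw [abs_mul, abs_of_nonneg (hθ.1 k)]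
        exact mul_le_mul_of_nonneg_left (hE k) (hθ.1 k)
    refine (Finset.abs_sum_le_sum_abs _ _).trans ((Finset.sum_le_sum fun k _ => h1 k).trans ?_)
    rw [Finset.sum_add_distrib, ← Finset.sum_mul Finset.univ θ, hθ.2]
    simp
  have hl : |freq n l - θ l| ≤ ‖freq n - θ‖ := norm_le_pi_norm (freq n - θ) l
  simp only [hterm, Finset.sum_add_distrib, ← Finset.mul_sum]
  rw [hfirst, ← add_assoc, ← mul_add, neg_add_eq_sub, ← Finset.sum_sub_distrib]
  refine (abs_add_le _ _).trans (add_le_add ?_ hsecond)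
  rw [abs_mul, abs_mul, abs_two]
  gcongr

/-- Drift of the squared distance between a value `z` with derivative `-hz` and a solution `f` of
the Hamilton-Jacobi equation of a player in state `l`, along the configurations seen by a player in
state `i`. -/
lemma abs_value_drift_le {β : Control d N} {t B E G : ℝ} {f : Conf d N → ℝ} (z hz hf : ℝ)
    (hB : ∀ n k j, |β t n k j| ≤ B) (i l : Fin d) (n : Conf d N)
    (hG : ∀ k j, |f (shift n k j) - f n| ≤ G)
    (hE : ∀ k j, |β t (shift n k l) k j - β t (shift n k i) k j| ≤ E) :
    |2 * (z - f n) * (-hz - -(∑ k, ∑ j, confRate β t l n k j * (f (shift n k j) - f n) + hf))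
        + ∑ k, ∑ j, confRate β t i n k j * ((z - f (shift n k j)) ^ 2 - (z - f n) ^ 2)|
      ≤ 2 * |z - f n| * (|hf - hz| + d * (N * (E * G))) + d * (N * (B * G ^ 2)) := by
  set D : Fin d → Fin d → ℝ := fun k j => f (shift n k j) - f n with hD
  have hG0 : 0 ≤ G := (abs_nonneg _).trans (hG i i)
  -- The equation for `f` uses the rates when the reference player is in state `l`, the chain those
  -- for state `i`. The linear parts cancel up to this mismatch, leaving a quadratic variation.
  have hid : 2 * (z - f n) * (-hz - -(∑ k, ∑ j, confRate β t l n k j * (f (shift n k j) - f n) + hf))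
        + ∑ k, ∑ j, confRate β t i n k j * ((z - f (shift n k j)) ^ 2 - (z - f n) ^ 2)
      = 2 * (z - f n) * ((hf - hz)
          + ∑ k, ∑ j, (confRate β t l n k j - confRate β t i n k j) * D k j)
        + ∑ k, ∑ j, confRate β t i n k j * D k j ^ 2 := by
    have h1 : ∀ k j, confRate β t i n k j * ((z - f (shift n k j)) ^ 2 - (z - f n) ^ 2)
        = -(2 * (z - f n) * (confRate β t i n k j * D k j))
          + confRate β t i n k j * D k j ^ 2 := fun k j => by
      simp only [hD]; ring
    simp only [h1, Finset.sum_add_distrib, Finset.sum_neg_distrib, ← Finset.mul_sum, sub_mul,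
      Finset.sum_sub_distrib]
    ring
  have hfirst : |∑ k, ∑ j, (confRate β t l n k j - confRate β t i n k j) * D k j|
      ≤ d * (N * (E * G)) := by
    refine abs_sum_sum_le (n := n) fun k j => ?_
    rw [confRate, confRate, ← mul_sub, mul_assoc, abs_mul, abs_mul, Nat.abs_cast]
    refine mul_le_mul_of_nonneg_left ?_ (Nat.cast_nonneg _)
    exact mul_le_mul (hE k j) (hG k j) (abs_nonneg _) ((abs_nonneg _).trans (hE k j))
  have hsecond : |∑ k, ∑ j, confRate β t i n k j * D k j ^ 2| ≤ d * (N * (B * G ^ 2)) := by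
    refine abs_sum_sum_le (n := n) fun k j => ?_
    rw [abs_mul, ← mul_assoc, abs_of_nonneg (sq_nonneg (D k j))]
    refine mul_le_mul (abs_confRate_le hB i n k j) ?_ (sq_nonneg _)
      ((abs_nonneg _).trans (abs_confRate_le hB i n k j))
    exact sq_le_sq' (abs_le.1 (hG k j)).1 (abs_le.1 (hG k j)).2
  rw [hid]
  refine (abs_add_le _ _).trans (add_le_add ?_ hsecond)
  rw [abs_mul, abs_mul, abs_two]
  gcongr
  exact (abs_add_le _ _).trans (by gcongr)

/-! ### Squared deviations along the game process -/

lemma IsNashEquilibrium.sum_row_eq_zero {T : ℝ} {β : Control d N}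
    {v : ℝ → Conf d N → Fin d → ℝ} (h : IsNashEquilibrium c ψ T β v) {t : ℝ} (ht : t ∈ Icc 0 T)
    (n : Conf d N) (k : Fin d) : ∑ j, β t n k j = 0 := by
  rw [← Finset.add_sum_erase _ _ (Finset.mem_univ k), h.admissible.diag t ht]
  ring

/-- The maximum norm is not differentiable, so the estimates are made for sums of squares, which
dominate its square. -/
lemma sq_norm_le_sum_sq (x : Fin d → ℝ) : ‖x‖ ^ 2 ≤ ∑ l, x l ^ 2 := by
  have h0 : 0 ≤ ∑ l, x l ^ 2 := Finset.sum_nonneg fun _ _ => sq_nonneg _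
  rw [← Real.le_sqrt (norm_nonneg _) h0, pi_norm_le_iff_of_nonneg (Real.sqrt_nonneg _)]
  intro l
  rw [Real.norm_eq_abs]
  exact Real.abs_le_sqrt (Finset.single_le_sum (f := fun l => x l ^ 2)
    (fun _ _ => sq_nonneg _) (Finset.mem_univ l))

/-- The squared deviation of the empirical distribution. -/
noncomputable def distDev (θ : ℝ → Fin d → ℝ) (t : ℝ) (x : Fin d × Conf d N) : ℝ :=
  ∑ l, (freq x.2 l - θ t l) ^ 2

/-- The squared deviation of the value function. -/
noncomputable def valueDev (u : ℝ → Fin d → ℝ) (v : ℝ → Conf d N → Fin d → ℝ) (t : ℝ)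
    (x : Fin d × Conf d N) : ℝ :=
  ∑ l, (u t l - v t x.2 l) ^ 2

set_option maxHeartbeats 1000000 in
/-- Along the game process, both squared deviations have a drift that is controlled by their
sum, up to `1 / N`. -/
lemma IsGameData.exists_drift_bound (h : IsGameData c ψ) {Tstar : ℝ}
    (hg : IsGradientHorizon c ψ Tstar) :
    ∃ A : ℝ, 0 < A ∧ ∀ T : ℝ, 0 < T → T < Tstar → ∀ (θ₀ : Fin d → ℝ) (θ u : ℝ → Fin d → ℝ),
      IsMeanFieldSolution c ψ T θ₀ θ u → ∀ N : ℕ, 1 ≤ N →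
      ∀ (β : Control d N) (v : ℝ → Conf d N → Fin d → ℝ), IsNashEquilibrium c ψ T β v →
      ∀ [Fintype (Conf d N)] [DecidableEq (Fin d × Conf d N)], ∀ t ∈ Ico 0 T,
      ∀ x : Fin d × Conf d N, ∃ f₁ f₂ : ℝ,
        HasDerivWithinAt (fun s => distDev θ s x) f₁ (Ici t) t ∧
        HasDerivWithinAt (fun s => valueDev u v s x) f₂ (Ici t) t ∧
        |f₁ + ∑ y ∈ Finset.univ.erase x, jumpRate β β t x y * (distDev θ t y - distDev θ t x)|
          ≤ A * (distDev θ t x + valueDev u v t x + 1 / N) ∧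
        |f₂ + ∑ y ∈ Finset.univ.erase x, jumpRate β β t x y * (valueDev u v t y - valueDev u v t x)|
          ≤ A * (distDev θ t x + valueDev u v t x + 1 / N) := by
  obtain ⟨hTs, C₀, hC₀, hgrad⟩ := hg
  obtain ⟨M₁, hM₁, hbound₁⟩ := h.exists_valueFunction_bound Tstar
  obtain ⟨M₂, hM₂, hbound₂⟩ := h.exists_meanField_bound Tstar
  obtain ⟨Lα, hLα, hα⟩ := h.exists_lipschitz_alphaStar
  obtain ⟨Lh, hLh, hh⟩ := h.exists_lipschitz_ham (max M₁ M₂)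
  -- `A₁` and `A₂` collect the coefficients of the drift of one coordinate once each of `δ²`, `η²`,
  -- `2δη`, `2δε`, `2ηε` and `ε` is bounded by `Q = δ² + η² + ε`, with `ε = 1/N`.
  set A₁ : ℝ := 3 * (d * Lh) + Lα * (2 * C₀ + 1) + 3 * Lα with hA₁
  set A₂ : ℝ := 3 * Lh + d * (Lα * (4 * C₀ + 2) * (2 * C₀)) + d * (Lh * (2 * C₀) ^ 2) with hA₂
  have hA₁0 : 0 ≤ A₁ := by positivity
  have hA₂0 : 0 ≤ A₂ := by positivity
  refine ⟨d * (A₁ + A₂) + 1, by positivity, ?_⟩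
  intro T hT hTT θ₀ θ u hs N hN β v hnash _ _ t ht x
  obtain ⟨i, n⟩ := x
  have htmem : t ∈ Icc 0 T := ⟨ht.1, ht.2.le⟩
  have hNpos : (0 : ℝ) < N := by exact_mod_cast hN
  have hN1 : (1 : ℝ) ≤ N := by exact_mod_cast hN
  have hIcc : Icc 0 T ∈ nhdsWithin t (Ici t) :=
    Filter.mem_of_superset (Icc_mem_nhdsGE ht.2) (Icc_subset_Icc_left ht.1)
  have hvb : ∀ m, ‖v t m‖ ≤ max M₁ M₂ := fun m =>
    (hbound₁ T hT hTT.le N hN β v hnash.admissible hnash.value t htmem m).trans (le_max_left _ _)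
  have hub : ‖u t‖ ≤ max M₁ M₂ := (hbound₂ T hT hTT.le θ₀ θ u hs t htmem).trans (le_max_right _ _)
  have hθ := hs.mem_simplex t htmem
  have hfr : ∀ m : Conf d N, freq m ∈ stdSimplex ℝ (Fin d) := freq_mem_stdSimplex hN
  have hB : ∀ n k j, |β t n k j| ≤ Lh := fun m k j => by
    rw [hnash.fixed_point t htmem]
    exact (hh k _ (hfr m) (v t m) (hvb m)).1 j
  have hG : ∀ (m : Conf d N) k j l, |v t (shift m k j) l - v t m l| ≤ 2 * C₀ / N := by
    intro m k j l
    rcases Nat.eq_zero_or_pos (m.1 k) with h0 | h0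
    · rw [shift_of_eq_zero h0, sub_self, abs_zero]; positivity
    · exact hgrad T hT hTT N hN β v hnash t htmem m l j k h0
  have hGn : ∀ (m : Conf d N) k j, ‖v t (shift m k j) - v t m‖ ≤ 2 * C₀ / N := fun m k j =>
    (pi_norm_le_iff_of_nonneg (by positivity)).2 fun l => hG m k j l
  set δ := ‖freq n - θ t‖ with hδ
  set η := ‖u t - v t n‖ with hη
  have hδ0 : 0 ≤ δ := norm_nonneg _
  have hη0 : 0 ≤ η := norm_nonneg _
  set ε : ℝ := 1 / N with hε
  have hε0 : 0 < ε := by positivity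
  have hε1 : ε ≤ 1 := by rw [hε, div_le_one hNpos]; exact hN1
  have hCε : 2 * C₀ / N = 2 * C₀ * ε := by rw [hε]; ring
  have hNε : N * ε = 1 := by rw [hε]; field_simp
  have hdev : δ ^ 2 + η ^ 2 + ε ≤ distDev θ t (i, n) + valueDev u v t (i, n) + ε := by
    have h1 := sq_norm_le_sum_sq (freq n - θ t)
    have h2 := sq_norm_le_sum_sq (u t - v t n)
    simp only [Pi.sub_apply] at h1 h2
    simp only [distDev, valueDev]
    linarith
  have e1 : 2 * δ * η ≤ δ ^ 2 + η ^ 2 := by nlinarith [sq_nonneg (δ - η)]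
  have hεsq : ε ^ 2 ≤ ε := by nlinarith
  have e2 : 2 * δ * ε ≤ δ ^ 2 + η ^ 2 + ε := by nlinarith [sq_nonneg (δ - ε), sq_nonneg η]
  have e3 : 2 * η * ε ≤ δ ^ 2 + η ^ 2 + ε := by nlinarith [sq_nonneg (η - ε), sq_nonneg δ]
  set Q := δ ^ 2 + η ^ 2 + ε with hQ
  have hQ0 : 0 ≤ Q := by positivity
  have e4 : δ ^ 2 ≤ Q := by nlinarith [sq_nonneg η]
  have e5 : η ^ 2 ≤ Q := by nlinarith [sq_nonneg δ]
  have e6 : ε ≤ Q := by nlinarith [sq_nonneg δ, sq_nonneg η]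
  have e7 : 2 * δ * η ≤ Q := by linarith
  refine ⟨∑ l, 2 * (freq n l - θ t l)
      * -(∑ k, θ t k * alphaStar c (diffOp k (u t)) (θ t) k l),
    ∑ l, 2 * (u t l - v t n l) * (-ham c (diffOp l (u t)) (θ t) l
      - -(∑ k, ∑ j, confRate β t l n k j * (v t (shift n k j) l - v t n l)
        + ham c (diffOp l (v t n)) (freq n) l)), ?_, ?_, ?_, ?_⟩
  · refine HasDerivWithinAt.fun_sum fun l _ => ?_
    have h1 := (((hs.kolmogorov t htmem l).mono_of_mem_nhdsWithin hIcc).const_sub (freq n l)).fun_pow 2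
    simpa using h1
  · refine HasDerivWithinAt.fun_sum fun l _ => ?_
    have h1 := (((hs.hamilton_jacobi t htmem l).mono_of_mem_nhdsWithin hIcc).fun_sub
      ((hnash.value.hamilton_jacobi t htmem n l).mono_of_mem_nhdsWithin hIcc)).fun_pow 2
    simpa using h1
  · refine le_trans ?_ (mul_le_mul_of_nonneg_left hdev (by positivity))
    have h1 := sum_jumpRate_mul β β t (i, n) fun m => ∑ l, (freq m l - θ t l) ^ 2
    simp only at h1
    simp only [distDev]
    rw [h1]
    have h2 : ∑ k, ∑ j, confRate β t i n k j * (∑ l, (freq (shift n k j) l - θ t l) ^ 2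
          - ∑ l, (freq n l - θ t l) ^ 2)
        = ∑ l, ∑ k, ∑ j, confRate β t i n k j * ((freq (shift n k j) l - θ t l) ^ 2
          - (freq n l - θ t l) ^ 2) := by
      symm
      refine Finset.sum_comm.trans (Finset.sum_congr rfl fun k _ => Finset.sum_comm.trans
        (Finset.sum_congr rfl fun j _ => ?_))
      rw [← Finset.sum_sub_distrib, Finset.mul_sum]
    rw [h2, ← Finset.sum_add_distrib]
    have hl : ∀ l, |2 * (freq n l - θ t l)
          * -(∑ k, θ t k * alphaStar c (diffOp k (u t)) (θ t) k l)
        + ∑ k, ∑ j, confRate β t i n k j * ((freq (shift n k j) l - θ t l) ^ 2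
          - (freq n l - θ t l) ^ 2)| ≤ A₁ * Q := by
      intro l
      -- A player in state `k` sees a configuration one move away from `n`, which costs `2 C₀ ε` in
      -- the value and `ε` in the distribution, on top of `η` and `δ`.
      refine (abs_distribution_drift_le (E := Lα * ((2 * C₀ + 1) * ε + η + δ)) hN hθ hB
        (hnash.sum_row_eq_zero htmem) i n l fun k => ?_).trans ?_
      · rw [hnash.fixed_point t htmem]
        refine (hα k _ (hfr _) _ hθ _ _ l).trans ?_
        have h3 : ‖v t (shift n k i) - u t‖ ≤ 2 * C₀ * ε + η := by
          rw [hη, norm_sub_rev (u t), ← hCε]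
          exact (norm_sub_le_norm_sub_add_norm_sub _ (v t n) _).trans
            (add_le_add (hGn n k i) le_rfl)
        have h4 : ‖freq (shift n k i) - θ t‖ ≤ ε + δ :=
          (norm_sub_le_norm_sub_add_norm_sub _ (freq n) _).trans
            (add_le_add (norm_freq_shift_sub_le n k i) le_rfl)
        refine mul_le_mul_of_nonneg_left ?_ hLα.le
        linarith
      · rw [← hδ]
        have h3 : (d : ℝ) * Lh / N = d * Lh * ε := by rw [hε]; ring
        have h4 : 0 ≤ d * Lh := by positivity
        have h5 : 0 ≤ Lα * (2 * C₀ + 1) := by positivity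
        have m1 := mul_le_mul_of_nonneg_left e4 h4
        have m2 := mul_le_mul_of_nonneg_left e6 h4
        have m3 := mul_le_mul_of_nonneg_left e2 h5
        have m4 := mul_le_mul_of_nonneg_left e7 hLα.le
        have m5 := mul_le_mul_of_nonneg_left e4 hLα.le
        rw [h3, hA₁]
        linarith
    refine (Finset.abs_sum_le_sum_abs _ _).trans
      ((Finset.sum_le_card_nsmul _ _ (A₁ * Q) fun l _ => hl l).trans ?_)
    simp only [Finset.card_univ, Fintype.card_fin, nsmul_eq_mul]
    have : 0 ≤ d * (A₂ * Q) + Q := by positivity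
    linarith
  · refine le_trans ?_ (mul_le_mul_of_nonneg_left hdev (by positivity))
    have h1 := sum_jumpRate_mul β β t (i, n) fun m => ∑ l, (u t l - v t m l) ^ 2
    simp only at h1
    simp only [valueDev]
    rw [h1]
    have h2 : ∑ k, ∑ j, confRate β t i n k j * (∑ l, (u t l - v t (shift n k j) l) ^ 2
          - ∑ l, (u t l - v t n l) ^ 2)
        = ∑ l, ∑ k, ∑ j, confRate β t i n k j * ((u t l - v t (shift n k j) l) ^ 2
          - (u t l - v t n l) ^ 2) := by
      symm
      refine Finset.sum_comm.trans (Finset.sum_congr rfl fun k _ => Finset.sum_comm.trans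
        (Finset.sum_congr rfl fun j _ => ?_))
      rw [← Finset.sum_sub_distrib, Finset.mul_sum]
    rw [h2, ← Finset.sum_add_distrib]
    have hl : ∀ l, |2 * (u t l - v t n l) * (-ham c (diffOp l (u t)) (θ t) l
          - -(∑ k, ∑ j, confRate β t l n k j * (v t (shift n k j) l - v t n l)
            + ham c (diffOp l (v t n)) (freq n) l))
        + ∑ k, ∑ j, confRate β t i n k j * ((u t l - v t (shift n k j) l) ^ 2
          - (u t l - v t n l) ^ 2)| ≤ A₂ * Q := by
      intro l
      -- The configurations seen for reference states `l` and `i` are each one move from `n`, hence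
      -- twice `(2 C₀ + 1) ε`. With jumps of size `G = O(ε)`, the mismatch `N E G` is again `O(ε)`.
      refine (abs_value_drift_le (f := fun m => v t m l) (E := Lα * ((4 * C₀ + 2) * ε))
        (G := 2 * C₀ * ε) (u t l) _ _ hB i l n (fun k j => hCε ▸ hG n k j l)
        fun k j => ?_).trans ?_
      · rw [hnash.fixed_point t htmem, hnash.fixed_point t htmem]
        refine (hα k _ (hfr _) _ (hfr _) _ _ j).trans (mul_le_mul_of_nonneg_left ?_ hLα.le)
        have h3 := norm_sub_le_norm_sub_add_norm_sub (v t (shift n k l)) (v t n) (v t (shift n k i))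
        have h4 := norm_sub_le_norm_sub_add_norm_sub (freq (shift n k l)) (freq n)
          (freq (shift n k i))
        rw [norm_sub_rev (v t n)] at h3
        rw [norm_sub_rev (freq n)] at h4
        have h5 := hGn n k l
        have h6 := hGn n k i
        have h7 := norm_freq_shift_sub_le n k l
        have h8 := norm_freq_shift_sub_le n k i
        rw [hCε] at h5 h6
        rw [← hε] at h7 h8
        linarith
      · have h3 : |u t l - v t n l| ≤ η := norm_le_pi_norm (u t - v t n) l
        have h4 := (hh l _ (hfr n) (v t n) (hvb n)).2 _ hθ (u t) hub
        rw [norm_sub_rev (v t n), ← hη, ← hδ] at h4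
        have h5 : d * (N * (Lα * ((4 * C₀ + 2) * ε) * (2 * C₀ * ε)))
            = d * (Lα * (4 * C₀ + 2) * (2 * C₀)) * ε := by
          linear_combination (d * (Lα * (4 * C₀ + 2) * (2 * C₀)) * ε) * hNε
        have h6 : d * (N * (Lh * (2 * C₀ * ε) ^ 2)) = d * (Lh * (2 * C₀) ^ 2) * ε := by
          linear_combination (d * (Lh * (2 * C₀) ^ 2) * ε) * hNε
        rw [h5, h6]
        set κ := d * (Lα * (4 * C₀ + 2) * (2 * C₀)) with hκ
        have hκ0 : 0 ≤ κ := by positivity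
        have h7 : 0 ≤ d * (Lh * (2 * C₀) ^ 2) := by positivity
        calc _ ≤ 2 * η * (Lh * (η + δ) + κ * ε) + d * (Lh * (2 * C₀) ^ 2) * ε := by gcongr
          _ ≤ A₂ * Q := by
            have m1 := mul_le_mul_of_nonneg_left e5 hLh.le
            have m2 := mul_le_mul_of_nonneg_left e7 hLh.le
            have m3 := mul_le_mul_of_nonneg_left e3 hκ0
            have m4 := mul_le_mul_of_nonneg_left e6 h7
            rw [hA₂]
            linarith
    refine (Finset.abs_sum_le_sum_abs _ _).trans
      ((Finset.sum_le_card_nsmul _ _ (A₂ * Q) fun l _ => hl l).trans ?_)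
    simp only [Finset.card_univ, Fintype.card_fin, nsmul_eq_mul]
    have : 0 ≤ d * (A₁ * Q) + Q := by positivity
    linarith

lemma IsMeanFieldSolution.continuousOn_distDev {T : ℝ} {θ₀ : Fin d → ℝ} {θ u : ℝ → Fin d → ℝ}
    (h : IsMeanFieldSolution c ψ T θ₀ θ u) (x : Fin d × Conf d N) :
    ContinuousOn (fun t => distDev θ t x) (Icc 0 T) :=
  continuousOn_finsetSum _ fun l _ => (continuousOn_const.sub fun t ht =>
    (h.kolmogorov t ht l).continuousWithinAt).pow 2

lemma IsMeanFieldSolution.continuousOn_valueDev {T : ℝ} {θ₀ : Fin d → ℝ} {θ u : ℝ → Fin d → ℝ}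
    {β : Control d N} {v : ℝ → Conf d N → Fin d → ℝ} (h : IsMeanFieldSolution c ψ T θ₀ θ u)
    (hv : IsValueFunction c ψ T β v) (x : Fin d × Conf d N) :
    ContinuousOn (fun t => valueDev u v t x) (Icc 0 T) :=
  continuousOn_finsetSum _ fun l _ => (ContinuousOn.sub
    (fun t ht => (h.hamilton_jacobi t ht l).continuousWithinAt)
    fun t ht => (hv.hamilton_jacobi t ht x.2 l).continuousWithinAt).pow 2

/-- A quantity with a drift bounded by `G` changes by at most `G * (t - s)` in mean. -/
lemma IsMarkovChain.abs_integral_sub_le {S Ω : Type*} [Fintype S] [DecidableEq S]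
    [MeasurableSpace S] [MeasurableSingletonClass S] [MeasurableSpace Ω] {P : Measure Ω}
    [IsProbabilityMeasure P] {T : ℝ} {q : ℝ → S → S → ℝ} {X : ℝ → Ω → S}
    (hX : IsMarkovChain P T q X) {B : ℝ} (hq : ∀ t ∈ Icc 0 T, ∀ x y, |q t x y| ≤ B)
    {f f' g : ℝ → S → ℝ} {G : ℝ} (hfc : ∀ x, ContinuousOn (fun t => f t x) (Icc 0 T))
    (hf : ∀ t ∈ Ico 0 T, ∀ x, HasDerivWithinAt (fun s => f s x) (f' t x) (Ici t) t)
    (hg : ∀ t ∈ Ico 0 T, ∀ x,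
      |f' t x + ∑ y ∈ Finset.univ.erase x, q t x y * (f t y - f t x)| ≤ g t x)
    (hG : ∀ t ∈ Ico 0 T, ∫ ω, g t (X t ω) ∂P ≤ G) {s t : ℝ} (hs : 0 ≤ s) (hst : s ≤ t)
    (ht : t ≤ T) :
    |∫ ω, f t (X t ω) ∂P - ∫ ω, f s (X s ω) ∂P| ≤ G * (t - s) := by
  have hsub : Icc s t ⊆ Icc 0 T := Icc_subset_Icc hs ht
  have hsub' : Ico s t ⊆ Ico 0 T := Ico_subset_Ico hs ht
  refine norm_image_sub_le_of_norm_deriv_right_le_segment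
    ((hX.continuousOn_integral hq hfc).mono hsub)
    (fun r hr => hX.hasDerivWithinAt_integral (hsub' hr) (hf r (hsub' hr)))
    (fun r hr => ?_) t (right_mem_Icc.2 hst)
  have hr' := hsub' hr
  refine le_trans ?_ (hG r hr')
  rw [integral_comp_eq_sum (hX.measurable r ⟨hr'.1, hr'.2.le⟩) (g r), Real.norm_eq_abs]
  refine (Finset.abs_sum_le_sum_abs _ _).trans (Finset.sum_le_sum fun x _ => ?_)
  rw [abs_mul, abs_of_nonneg measureReal_nonneg]
  exact mul_le_mul_of_nonneg_left (hg r hr' x) measureReal_nonneg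

/-- The mean squared deviations between the game with `N + 1` players and the mean field game. -/
theorem IsGameData.exists_deviation_bound (h : IsGameData c ψ) {Tstar : ℝ}
    (hgrad : IsGradientHorizon c ψ Tstar) :
    ∃ C : ℝ, 0 < C ∧ ∀ T : ℝ, 0 < T → T < Tstar → T * C < 1 →
      ∀ θ₀ ∈ stdSimplex ℝ (Fin d), ∀ θ u : ℝ → Fin d → ℝ, IsMeanFieldSolution c ψ T θ₀ θ u →
      ∀ N : ℕ, 1 ≤ N → ∀ (β : Control d N) (v : ℝ → Conf d N → Fin d → ℝ),
      IsNashEquilibrium c ψ T β v →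
      ∀ (Ω : Type*) [MeasurableSpace Ω] (P : Measure Ω) [IsProbabilityMeasure P]
        (X : ℝ → Ω → Fin d × Conf d N), IsGameProcess P T θ₀ β X → ∀ t ∈ Icc 0 T,
      (∫ ω, distDev θ t (X t ω) ∂P) + (∫ ω, valueDev u v t (X t ω) ∂P)
        ≤ C / (1 - T * C) * (1 / (N : ℝ)) := by
  classical
  obtain ⟨A, hA, hdrift⟩ := h.exists_drift_bound hgrad
  obtain ⟨K, hK⟩ := h.lipschitz_terminal
  have hTstar := hgrad.1
  -- Read off from `m ≤ d(1 + dK²)/N + (2 + dK²) A T (m + 1/N)`. In the factor `1 + Tstar`, the `1`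
  -- serves the term in `T m` and `Tstar` bounds `T` in the term in `1/N`.
  set C : ℝ := d * (1 + d * K ^ 2) + (2 + d * K ^ 2) * A * (1 + Tstar) with hC
  refine ⟨C, by positivity, ?_⟩
  intro T hT hTT hTC θ₀ hθ₀ θ u hs N hN β v hnash Ω _ P _ X hX t ht
  let _ : Fintype (Conf d N) := Fintype.ofFinite _
  have hNpos : (0 : ℝ) < N := by exact_mod_cast hN
  obtain ⟨B, hB⟩ := hnash.admissible.bounded
  have hq : ∀ t ∈ Icc 0 T, ∀ x y, |jumpRate β β t x y| ≤ B + d * (d * (N * B)) :=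
    fun t ht x y => abs_jumpRate_le (hB t ht) (hB t ht) x y
  have hchain := hX.chain
  have hc₁ : ∀ x : Fin d × Conf d N, ContinuousOn (fun t => distDev θ t x) (Icc 0 T) :=
    hs.continuousOn_distDev
  have hc₂ : ∀ x, ContinuousOn (fun t => valueDev u v t x) (Icc 0 T) :=
    hs.continuousOn_valueDev hnash.value
  set D₁ : ℝ → ℝ := fun t => ∫ ω, distDev θ t (X t ω) ∂P with hD₁
  set D₂ : ℝ → ℝ := fun t => ∫ ω, valueDev u v t (X t ω) ∂P with hD₂
  -- At a maximal time `r` of `D₁ + D₂`, its value `m` bounds both drifts on the whole interval,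
  -- whichever end they are integrated from.
  obtain ⟨r, hr, hmax⟩ := isCompact_Icc.exists_isMaxOn ⟨t, ht⟩
    ((hchain.continuousOn_integral hq hc₁).add (hchain.continuousOn_integral hq hc₂))
  have hmax' : ∀ t ∈ Icc 0 T, D₁ t + D₂ t ≤ D₁ r + D₂ r := fun t ht => hmax ht
  set m := D₁ r + D₂ r with hm
  have hdrift' := hdrift T hT hTT θ₀ θ u hs N hN β v hnash
  choose! f₁ f₂ hf₁ hf₂ hg₁ hg₂ using hdrift'
  have hG : ∀ t ∈ Ico 0 T, ∫ ω, (fun s x => A * (distDev θ s x + valueDev u v s x + 1 / N)) t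
      (X t ω) ∂P ≤ A * (m + 1 / N) := by
    intro t ht
    have htm : t ∈ Icc 0 T := ⟨ht.1, ht.2.le⟩
    have hmeas := hchain.measurable t htm
    have h1 := hmax' t htm
    have h2 := sum_real_eq_one (P := P) hmeas
    simp only [hD₁, hD₂] at h1
    rw [integral_comp_eq_sum hmeas, integral_comp_eq_sum hmeas] at h1
    refine (integral_comp_eq_sum hmeas
      fun x => A * (distDev θ t x + valueDev u v t x + 1 / N)).trans_le ?_
    have h3 : ∑ x, P.real {ω | X t ω = x} * (A * (distDev θ t x + valueDev u v t x + 1 / N))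
        = A * ((∑ x, P.real {ω | X t ω = x} * distDev θ t x
          + ∑ x, P.real {ω | X t ω = x} * valueDev u v t x)
          + (∑ x, P.real {ω | X t ω = x}) * (1 / N)) := by
      rw [Finset.sum_mul, ← Finset.sum_add_distrib, ← Finset.sum_add_distrib, Finset.mul_sum]
      exact Finset.sum_congr rfl fun x _ => by ring
    rw [h3, h2, one_mul]
    gcongr
  have hinc₁ : ∀ t ∈ Icc 0 T, |D₁ t - D₁ 0| ≤ A * (m + 1 / N) * (t - 0) := fun t ht =>
    hchain.abs_integral_sub_le hq hc₁ hf₁ hg₁ hG le_rfl ht.1 ht.2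
  have hinc₂ : |D₂ T - D₂ r| ≤ A * (m + 1 / N) * (T - r) :=
    hchain.abs_integral_sub_le hq hc₂ hf₂ hg₂ hG hr.1 hr.2 le_rfl
  have hD₁nn : ∀ t, 0 ≤ D₁ t := fun t =>
    integral_nonneg fun ω => Finset.sum_nonneg fun _ _ => sq_nonneg _
  have hD₂nn : ∀ t, 0 ≤ D₂ t := fun t =>
    integral_nonneg fun ω => Finset.sum_nonneg fun _ _ => sq_nonneg _
  have hm0 : 0 ≤ m := add_nonneg (hD₁nn r) (hD₂nn r)
  have hinit : D₁ 0 ≤ d * (1 / N) := by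
    have hmeas : Measurable fun ω => (X 0 ω).2 :=
      measurable_snd.comp (hchain.measurable 0 (left_mem_Icc.2 hT.le))
    have h1 : D₁ 0 = ∑ n, P.real {ω | (X 0 ω).2 = n} * ∑ l, (freq n l - θ 0 l) ^ 2 :=
      integral_comp_eq_sum hmeas fun n => ∑ l, (freq n l - θ 0 l) ^ 2
    rw [h1, hs.initial]
    simp only [hX.initial, Finset.mul_sum]
    rw [Finset.sum_comm]
    exact (Finset.sum_le_card_nsmul _ _ (1 / (N : ℝ)) fun l _ =>
      sum_initialLaw_mul_sq_le hN hθ₀ l).trans (by simp)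
  have hterm : D₂ T ≤ d * K ^ 2 * D₁ T := by
    have hTm : T ∈ Icc 0 T := right_mem_Icc.2 hT.le
    have hmeas := hchain.measurable T hTm
    simp only [hD₁, hD₂]
    rw [integral_comp_eq_sum hmeas, integral_comp_eq_sum hmeas, Finset.mul_sum]
    refine Finset.sum_le_sum fun x _ => ?_
    rw [mul_left_comm]
    refine mul_le_mul_of_nonneg_left ?_ measureReal_nonneg
    have h1 : ∀ l, (u T l - v T x.2 l) ^ 2 ≤ K ^ 2 * distDev θ T x := fun l => by
      rw [hs.terminal, hnash.value.terminal]
      have h2 := hK l _ (freq_mem_stdSimplex hN x.2) _ (hs.mem_simplex T hTm)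
      rw [abs_sub_comm] at h2
      calc (ψ l (θ T) - ψ l (freq x.2)) ^ 2 ≤ (K * ‖freq x.2 - θ T‖) ^ 2 :=
            sq_le_sq' (abs_le.1 h2).1 (abs_le.1 h2).2
        _ = K ^ 2 * ‖freq x.2 - θ T‖ ^ 2 := mul_pow _ _ _
        _ ≤ _ := by
          refine mul_le_mul_of_nonneg_left ?_ (sq_nonneg K)
          exact sq_norm_le_sum_sq (freq x.2 - θ T)
    refine (Finset.sum_le_card_nsmul _ _ (K ^ 2 * distDev θ T x) fun l _ => h1 l).trans ?_
    simp [mul_assoc]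
  have hX0 : 0 ≤ A * (m + 1 / N) := by positivity
  have b₁ : ∀ t ∈ Icc 0 T, D₁ t ≤ d * (1 / N) + A * (m + 1 / N) * T := fun t ht => by
    have h1 := le_of_abs_le (hinc₁ t ht)
    have h2 : A * (m + 1 / N) * (t - 0) ≤ A * (m + 1 / N) * T :=
      mul_le_mul_of_nonneg_left (by linarith [ht.2]) hX0
    linarith
  -- The route is backward from `r` to `T`, through the terminal condition to `D₁ T`, then forward
  -- from time `0`.
  have b₂ : D₂ r ≤ d * K ^ 2 * (d * (1 / N) + A * (m + 1 / N) * T) + A * (m + 1 / N) * T := by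
    have h1 := (abs_le.1 hinc₂).1
    have h2 : A * (m + 1 / N) * (T - r) ≤ A * (m + 1 / N) * T :=
      mul_le_mul_of_nonneg_left (by linarith [hr.1]) hX0
    have h3 : d * K ^ 2 * D₁ T ≤ d * K ^ 2 * (d * (1 / N) + A * (m + 1 / N) * T) :=
      mul_le_mul_of_nonneg_left (b₁ T (right_mem_Icc.2 hT.le)) (by positivity)
    linarith
  have hfinal : m ≤ C * (1 / N) + T * C * m := by
    have h1 := b₁ r hr
    have h2 : m ≤ d * (1 + d * K ^ 2) * (1 / N) + (2 + d * K ^ 2) * A * T * (m + 1 / N) := by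
      rw [hm]
      linarith
    have hκ : 0 ≤ (2 + d * K ^ 2) * A := by positivity
    have h3 : (2 + d * K ^ 2) * A * T * (1 / N) ≤ (2 + d * K ^ 2) * A * (1 + Tstar) * (1 / N) := by
      gcongr
      linarith
    have h4 : (2 + d * K ^ 2) * A * T * m ≤ C * T * m := by
      gcongr
      rw [hC]
      have : 0 ≤ d * (1 + d * K ^ 2) + (2 + d * K ^ 2) * A * Tstar := by positivity
      linarith
    have h5 : C * (1 / N) = d * (1 + d * K ^ 2) * (1 / N)
        + (2 + d * K ^ 2) * A * (1 + Tstar) * (1 / N) := by rw [hC]; ring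
    linarith
  refine (hmax' t ht).trans ?_
  rw [div_mul_eq_mul_div, le_div_iff₀ (by linarith)]
  linarith

end MeanFieldGame

/-! ### Passage from sums of squares to the maximum norm -/

theorem theorem4p1 {d : ℕ} (c : Fin d → (Fin d → ℝ) → (Fin d → ℝ) → ℝ)
    (ψ : Fin d → (Fin d → ℝ) → ℝ) (hcψ : MeanFieldGame.IsGameData c ψ) :
    (∃ Tstar : ℝ, MeanFieldGame.IsGradientHorizon c ψ Tstar) ∧
    ∀ Tstar : ℝ, MeanFieldGame.IsGradientHorizon c ψ Tstar →
      ∃ C : ℝ, 0 < C ∧ ∀ T : ℝ, 0 < T → T < Tstar → T * C < 1 →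
        ∀ θ₀ ∈ stdSimplex ℝ (Fin d), ∀ θ u : ℝ → Fin d → ℝ,
          MeanFieldGame.IsMeanFieldSolution c ψ T θ₀ θ u →
        ∀ N : ℕ, 1 ≤ N →
        ∀ (β : MeanFieldGame.Control d N) (uN : ℝ → MeanFieldGame.Conf d N → Fin d → ℝ),
          MeanFieldGame.IsNashEquilibrium c ψ T β uN →
        ∀ (Ω : Type*) [MeasurableSpace Ω] (P : MeasureTheory.Measure Ω)
          [MeasureTheory.IsProbabilityMeasure P]
          (X : ℝ → Ω → Fin d × MeanFieldGame.Conf d N),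
          MeanFieldGame.IsGameProcess P T θ₀ β X →
        ∀ t ∈ Set.Icc 0 T,
          (∫ ω, ‖MeanFieldGame.freq (X t ω).2 - θ t‖ ^ 2 ∂P)
            + (∫ ω, ‖u t - uN t (X t ω).2‖ ^ 2 ∂P)
            ≤ C / (1 - T * C) * (1 / (N : ℝ)) := by
  refine ⟨hcψ.exists_gradientHorizon, fun Tstar hTstar => ?_⟩
  obtain ⟨C, hC, hbound⟩ := hcψ.exists_deviation_bound hTstar
  refine ⟨C, hC, ?_⟩
  intro T hT hTT hTC θ₀ hθ₀ θ u hs N hN β uN hnash Ω _ P _ X hX t ht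
  refine le_trans ?_ (hbound T hT hTT hTC θ₀ hθ₀ θ u hs N hN β uN hnash Ω P X hX t ht)
  have := Fintype.ofFinite (MeanFieldGame.Conf d N)
  have hmeas := hX.chain.measurable t ht
  have hint : ∀ F : Fin d × MeanFieldGame.Conf d N → ℝ,
      MeasureTheory.Integrable (fun ω => F (X t ω)) P := fun F =>
    (MeasureTheory.Integrable.of_finite (μ := P.map (X t)) (f := F)).comp_measurable hmeas
  refine add_le_add ?_ ?_
  · exact MeasureTheory.integral_mono
      (hint fun x => ‖MeanFieldGame.freq x.2 - θ t‖ ^ 2) (hint (MeanFieldGame.distDev θ t))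
      fun ω => MeanFieldGame.sq_norm_le_sum_sq (MeanFieldGame.freq (X t ω).2 - θ t)
  · exact MeasureTheory.integral_mono
      (hint fun x => ‖u t - uN t x.2‖ ^ 2) (hint (MeanFieldGame.valueDev u uN t))
      fun ω => MeanFieldGame.sq_norm_le_sum_sq (u t - uN t (X t ω).2)
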